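/- **Setting.** Let $y\in\mathbb R^{r_y}$ and $u\in\mathbb R^{r_u}$ be random vectors, uncorrelated with each other, each with mean zero and identity covariance, and let $x=Ay+Bu+c\in\mathbb R^{r_x}$, where for some matrix $D$ and vector $e$ we have $DB=0$, $DA=I$, $Dc=-e$ (so $y=Dx+e$), $\operatorname{rank}A=r_y<r_x$ and $\operatorname{rank}B\le r_x-r_y$. Assume that $Wy+Vu$ has the same law as $y$ if and only if $W=I$ and $V=0$. Write $\rho^x,\rho^y$ for the laws of $x,y$, let $r_c=\operatorname{rank}\mathbb E[xx^\top]$, and assume $r_z\ge r_c-r_y$. For $\gamma>0$ and parameters $\theta=(W_x,V_x,b_x,W_y,b_y)$, $\phi=(W_z,b_z,s)$ with $z\in\mathbb R^{r_z}$ and all $s_k\ne0$, put $\hat y(x)=W_yx+b_y$, $\mu_z(x)=W_zx+b_z$, $q_\phi(\cdot|x)=\mathcal N(\mu_z(x),\operatorname{diag}(s)^2)$, and $\ell_{\rm cycle}=\ell_x+\ell_y$ with $$\ell_x=\int\Big\{\mathbb E_{z\sim q_\phi(\cdot|x)}\big[\tfrac1\gamma\|x-W_x\hat y(x)-V_xz-b_x\|^2\big]+r_x\log\gamma+\sum_{k=1}^{r_z}(s_k^2-\log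 s_k^2)+\|\mu_z(x)\|^2\Big\}\rho^x(dx),$$ $$\ell_y=\int\big(\epsilon^\top\Sigma^{-1}\epsilon+\log|\Sigma|\big)\rho^y(dy),\qquad \epsilon=y-W_y(W_xy+b_x)-b_y,\quad \Sigma=\gamma I+W_yV_xV_x^\top W_y^\top .$$ Consider local (in particular global) minima of $\ell_{\rm cycle}$ over $(\theta,\phi)$, for fixed $\gamma$, subject to the constraint that $\hat y(x)$ has law $\rho^y$. A *minimum in the limit $\gamma\to0$* is a limit of a sequence of such minima for decoder variances $\gamma_n>0$, $\gamma_n\to0$. Let $\mathcal X=\{Ay+Bu+c:\ y\in\mathbb R^{r_y},u\in\mathbb R^{r_u}\}$. **Claim.** There is $\gamma_0>0$ such that the following holds for every such minimum with $0<\gamma<\gamma_0$, and, with $\gamma=0$, for every minimum in the limit $\gamma\to0$; denote its parameters by a star. There are a permutation matrix $P$, a matrix $\widetilde B$ with $\operatorname{rank}B$ columns $\widetilde B_k$ and the same column space as $B$, a matrix $\widetilde W_z^*$ with $\operatorname{rank}B$ rows, all nonzero, and $\widetilde b_z^*\in\mathbb R^{\operatorname{rank}B}$ with the following properties. 1. $V_x^*=[\widetilde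 B,0]P^\top$. 2. $W_z^*=P\begin{bmatrix}\widetilde W_z^*\\ R\end{bmatrix}$ and $b_z^*=P\begin{bmatrix}\widetilde b_z^*\\ r\end{bmatrix}$ with $Rx+r=0$ for all $x\in\mathcal X$; thus $W_z^*x+b_z^*=P\begin{bmatrix}\widetilde W_z^*x+\widetilde b_z^*\\ 0\end{bmatrix}$ on $\mathcal X$. If $r_y+\operatorname{rank}B=r_x$ (equivalently, $\mathcal X=\mathbb R^{r_x}$), then $R=0$ and $r=0$, that is, $W_z^*=P\begin{bmatrix}\widetilde W_z^*\\0\end{bmatrix}$ and $b_z^*=P\begin{bmatrix}\widetilde b_z^*\\0\end{bmatrix}$. The superfluous latent dimensions are pruned: they also have $(s_k^*)^2=1$, so on $\mathcal X$ their posterior is the prior $\mathcal N(0,1)$. 3. With $\widetilde\mu_z(x)=\widetilde W_z^*x+\widetilde b_z^*$, the map $x\mapsto(W_y^*x+b_y^*,\widetilde\mu_z(x))$ is a bijection from $\mathcal X$ onto $\mathbb R^{r_y}\times\mathbb R^{\operatorname{rank}B}$, its first component maps $x=Ay+Bu+c$ to $y$, and its inverse is the affine map $$(y,\widetilde\mu)\mapsto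 W_x^*y+V_x^*P\begin{bmatrix}\Lambda\widetilde\mu\\0\end{bmatrix}+c,\qquad \Lambda=\operatorname{diag}\big(1+\gamma/\|\widetilde B_k\|^2\big),$$ in which $\Lambda=I$ in the limit $\gamma\to0$. -/

import Mathlib

open MeasureTheory ProbabilityTheory Filter Topology Set Matrix

namespace CycleCVAE

noncomputable section

/-- The affine surjective ground-truth model for matched pairs `x = A y + B u + c`, `y = D x + e`:
`Y` and `U` are square-integrable random vectors on a common probability space, both of mean zero
and identity covariance, mutually uncorrelated, and `W Y + V U` has the law of `Y` only in the
trivial case `W = I`, `V = 0`. -/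
structure IsAffineSurjectiveModel {Ω : Type*} [MeasurableSpace Ω] (μ : Measure Ω)
    {rx ry ru : ℕ} (A : Matrix (Fin rx) (Fin ry) ℝ) (B : Matrix (Fin rx) (Fin ru) ℝ)
    (c : Fin rx → ℝ) (D : Matrix (Fin ry) (Fin rx) ℝ) (e : Fin ry → ℝ)
    (Y : Ω → Fin ry → ℝ) (U : Ω → Fin ru → ℝ) : Prop where
  D_mul_B : D * B = 0
  D_mul_A : D * A = 1
  D_mul_c : D *ᵥ c = -e
  rank_A : A.rank = ry
  ry_lt_rx : ry < rx
  rank_B : ry + B.rank ≤ rx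
  memLp_Y : MemLp Y 2 μ
  memLp_U : MemLp U 2 μ
  mean_Y : ∀ i, ∫ ω, Y ω i ∂μ = 0
  mean_U : ∀ i, ∫ ω, U ω i ∂μ = 0
  cov_Y : ∀ i j, covariance (fun ω => Y ω i) (fun ω => Y ω j) μ = if i = j then 1 else 0
  cov_U : ∀ i j, covariance (fun ω => U ω i) (fun ω => U ω j) μ = if i = j then 1 else 0
  uncorrelated : ∀ i j, covariance (fun ω => Y ω i) (fun ω => U ω j) μ = 0
  identifiable : ∀ (W : Matrix (Fin ry) (Fin ry) ℝ) (V : Matrix (Fin ry) (Fin ru) ℝ),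
    μ.map (fun ω => W *ᵥ Y ω + V *ᵥ U ω) = μ.map Y ↔ W = 1 ∧ V = 0

/-- The map `(y, u) ↦ x = A y + B u + c`. -/
def groundTruth {rx ry ru : ℕ} (A : Matrix (Fin rx) (Fin ry) ℝ) (B : Matrix (Fin rx) (Fin ru) ℝ)
    (c : Fin rx → ℝ) (y : Fin ry → ℝ) (u : Fin ru → ℝ) : Fin rx → ℝ :=
  A *ᵥ y + B *ᵥ u + c

/-- The data space: all `x` of the form `A y + B u + c`. -/
def dataSpace {rx ry ru : ℕ} (A : Matrix (Fin rx) (Fin ry) ℝ) (B : Matrix (Fin rx) (Fin ru) ℝ)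
    (c : Fin rx → ℝ) : Set (Fin rx → ℝ) :=
  {x | ∃ y u, x = groundTruth A B c y u}

/-- The law of `x = A Y + B U + c`. -/
def lawX {Ω : Type*} [MeasurableSpace Ω] (μ : Measure Ω) {rx ry ru : ℕ}
    (A : Matrix (Fin rx) (Fin ry) ℝ) (B : Matrix (Fin rx) (Fin ru) ℝ) (c : Fin rx → ℝ)
    (Y : Ω → Fin ry → ℝ) (U : Ω → Fin ru → ℝ) : Measure (Fin rx → ℝ) :=
  μ.map (fun ω => groundTruth A B c (Y ω) (U ω))

/-- The (uncentred) second-moment matrix `E[x xᵀ]`. -/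
def secondMoment {n : ℕ} (ρ : Measure (Fin n → ℝ)) : Matrix (Fin n) (Fin n) ℝ :=
  Matrix.of fun i j => ∫ x, x i * x j ∂ρ

/-- The parameters of the affine CycleCVAE, apart from the decoder variance `γ`. -/
structure Params (rx ry rz : ℕ) where
  Wx : Matrix (Fin rx) (Fin ry) ℝ
  Vx : Matrix (Fin rx) (Fin rz) ℝ
  bx : Fin rx → ℝ
  Wy : Matrix (Fin ry) (Fin rx) ℝ
  bY : Fin ry → ℝ
  Wz : Matrix (Fin rz) (Fin rx) ℝ
  bz : Fin rz → ℝ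
  s : Fin rz → ℝ

namespace Params

variable {rx ry rz : ℕ}

/-- The parameters as a tuple; it serves to give `Params` the topology of the finite-dimensional
product space. -/
def toProd (p : Params rx ry rz) :
    Matrix (Fin rx) (Fin ry) ℝ × Matrix (Fin rx) (Fin rz) ℝ × (Fin rx → ℝ) ×
      Matrix (Fin ry) (Fin rx) ℝ × (Fin ry → ℝ) ×
      Matrix (Fin rz) (Fin rx) ℝ × (Fin rz → ℝ) × (Fin rz → ℝ) :=
  (p.Wx, p.Vx, p.bx, p.Wy, p.bY, p.Wz, p.bz, p.s)

instance : TopologicalSpace (Params rx ry rz) :=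
  TopologicalSpace.induced toProd inferInstance

/-- `h⁺_θ(x) = W_y x + b_y`. -/
def yhat (p : Params rx ry rz) (x : Fin rx → ℝ) : Fin ry → ℝ := p.Wy *ᵥ x + p.bY

/-- `h_θ(y, z) = W_x y + V_x z + b_x`. -/
def decode (p : Params rx ry rz) (y : Fin ry → ℝ) (z : Fin rz → ℝ) : Fin rx → ℝ :=
  p.Wx *ᵥ y + p.Vx *ᵥ z + p.bx

/-- The encoder mean `μ_z = W_z x + b_z`. -/
def encMean (p : Params rx ry rz) (x : Fin rx → ℝ) : Fin rz → ℝ := p.Wz *ᵥ x + p.bz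

/-- The encoder distribution `q_φ(z | x) = N(μ_z, diag(s)²)`. -/
def encoder (p : Params rx ry rz) (x : Fin rx → ℝ) : Measure (Fin rz → ℝ) :=
  Measure.pi fun k => gaussianReal (p.encMean x k) ⟨p.s k ^ 2, sq_nonneg _⟩

/-- The CVAE energy of the cycle `x → ŷ → x̂`. -/
def lossX (ρx : Measure (Fin rx → ℝ)) (γ : ℝ) (p : Params rx ry rz) : ℝ :=
  ∫ x, ((∫ z, (1 / γ) *
            ((x - p.decode (p.yhat x) z) ⬝ᵥ (x - p.decode (p.yhat x) z)) ∂(p.encoder x))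
        + rx * Real.log γ
        + ∑ k, (p.s k ^ 2 - Real.log (p.s k ^ 2))
        + p.encMean x ⬝ᵥ p.encMean x) ∂ρx

/-- The covariance `γ I + W_y V_x V_xᵀ W_yᵀ` of `y` after the cycle `y → x̂ → ŷ`. -/
def covY (γ : ℝ) (p : Params rx ry rz) : Matrix (Fin ry) (Fin ry) ℝ :=
  γ • (1 : Matrix (Fin ry) (Fin ry) ℝ) + p.Wy * p.Vx * p.Vxᵀ * p.Wyᵀ

/-- The residual `y - (W_y (W_x y + b_x) + b_y)` of the cycle `y → x̂ → ŷ`. -/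
def residualY (p : Params rx ry rz) (y : Fin ry → ℝ) : Fin ry → ℝ :=
  y - p.yhat (p.decode y 0)

/-- The energy of the cycle `y → x̂ → ŷ`. -/
def lossY (ρy : Measure (Fin ry → ℝ)) (γ : ℝ) (p : Params rx ry rz) : ℝ :=
  ∫ y, (p.residualY y ⬝ᵥ ((p.covY γ)⁻¹ *ᵥ p.residualY y) + Real.log (p.covY γ).det) ∂ρy

/-- The cycle-consistent objective. -/
def lossCycle (ρx : Measure (Fin rx → ℝ)) (ρy : Measure (Fin ry → ℝ)) (γ : ℝ)
    (p : Params rx ry rz) : ℝ :=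
  p.lossX ρx γ + p.lossY ρy γ

/-- The feasible parameters: the encoder covariance is nondegenerate, and `ŷ = W_y x + b_y` has the
law of `y`. -/
def feasible (rz : ℕ) (ρx : Measure (Fin rx → ℝ)) (ρy : Measure (Fin ry → ℝ)) :
    Set (Params rx ry rz) :=
  {p | (∀ k, p.s k ≠ 0) ∧ ρx.map p.yhat = ρy}

/-- `p` is a (local) minimum of the constrained objective for decoder variance `γ`. -/
def IsMinimum (ρx : Measure (Fin rx → ℝ)) (ρy : Measure (Fin ry → ℝ)) (γ : ℝ)
    (p : Params rx ry rz) : Prop :=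
  p ∈ feasible rz ρx ρy ∧ IsLocalMinOn (lossCycle ρx ρy γ) (feasible rz ρx ρy) p

/-- `p` is a minimum in the limit `γ → 0`: a limit of (local) minima for decoder variances
`γ n > 0` that tend to `0`. -/
def IsLimitMinimum (ρx : Measure (Fin rx → ℝ)) (ρy : Measure (Fin ry → ℝ))
    (p : Params rx ry rz) : Prop :=
  ∃ (γ : ℕ → ℝ) (q : ℕ → Params rx ry rz), (∀ n, 0 < γ n) ∧ Tendsto γ atTop (𝓝 0) ∧
    (∀ n, IsMinimum ρx ρy (γ n) (q n)) ∧ Tendsto q atTop (𝓝 p)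

end Params

/-- The permutation matrix of a bijection `σ`; the rows of `permMatrix σ * M` are those of `M`,
permuted. -/
def permMatrix {m n : Type*} [DecidableEq m] [DecidableEq n] (σ : m ≃ n) : Matrix m n ℝ :=
  Matrix.of fun i j => if σ i = j then 1 else 0

end

end CycleCVAE

/-!
# Local minima of the affine CycleCVAE objective

Comparing means and using identifiability, the constraint on the law of `ŷ` says exactly that
`W_y A = I`, `W_y B = 0` and `b_y = -W_y c` (`IsAffineSurjectiveModel.mem_feasible_iff`), so that
the loss becomes an explicit function of the parameters (`lossX_eq`, `lossY_eq`). The quantities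
`A - W_x`, `c - b_x`, `W_z A` and `W_z c + b_z` enter it through a nonnegative quadratic form and
vanish at a local minimum (`eq_of_isMinimum`). With `V = V_x` and `N = W_z B`, what is left is
`(1/γ) (|B - V N|² + ∑ s_k² |v_k|²) + ∑ (s_k² - log s_k²) + |N|² + log det (γ I + W_y V Vᵀ W_yᵀ)`.

A local minimum of this function has the following structure.
* Shrinking the part of `V` orthogonal to the column space of `B` decreases every term, so `V` maps
  into that space and `W_y V = 0` (`mul_normal_equation`).
* Stationarity in `s`, `N` and `V` gives `s_k² (γ + |v_k|²) = γ`, `γ N = Vᵀ (B - V N)` and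
  `(B - V N) Nᵀ = V diag (s²)`.
* The columns of `V` are orthogonal: after elimination of `s` a rotation of the latent space changes
  only `∑ log (γ + |v_k|²)`, and a planar rotation of two columns that are not orthogonal decreases
  it, to first order if their lengths differ and to second order otherwise
  (`transpose_mul_self_apply_of_ne`).
* If `γ` is below the nonzero eigenvalues of `B Bᵀ`, then `V` and `B` have the same column space,
  since otherwise a zero column of `V` could be put to use (`range_le`).

Consequently the nonzero columns of `V` form an orthogonal basis of the column space of `B`,
`N_k = v_kᵀ B / (|v_k|² + γ)`, and `|v_k|² + γ` is at least `δ`, any lower bound for the nonzero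
eigenvalues of `B Bᵀ`. Because of this bound no column degenerates as `γ → 0`: the structure
is described by conditions that are closed in `(γ, p)` (`IsOptimal`, `isClosed_isOptimal`), hence it
passes to limits of minima. The permutation sorts the nonzero columns of `V` first, and `∑ v_k v_kᵀ B / |v_k|² = B`
gives the affine inverse (`IsOptimal.exists_sorted`).
-/

namespace CycleCVAE

/-! ### Second moments of affine images of random vectors -/

/-- The expected quadratic form of an affine image of a random vector whose components are
uncorrelated, with means `m k` and variances `v k`. -/
theorem integral_quadForm {Ω ι n : Type*} [MeasurableSpace Ω] {ν : Measure Ω}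
    [IsProbabilityMeasure ν] [Fintype ι] [DecidableEq ι] [Fintype n] {Z : Ω → ι → ℝ}
    {m v : ι → ℝ} (hL : ∀ k, MemLp (fun ω => Z ω k) 2 ν) (hm : ∀ k, ∫ ω, Z ω k ∂ν = m k)
    (hc : ∀ k l, covariance (fun ω => Z ω k) (fun ω => Z ω l) ν = if k = l then v k else 0)
    (M : Matrix n ι ℝ) (Q : Matrix n n ℝ) (h : n → ℝ) :
    Integrable (fun ω => (h + M *ᵥ Z ω) ⬝ᵥ (Q *ᵥ (h + M *ᵥ Z ω))) ν ∧
      ∫ ω, (h + M *ᵥ Z ω) ⬝ᵥ (Q *ᵥ (h + M *ᵥ Z ω)) ∂ν =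
        (h + M *ᵥ m) ⬝ᵥ (Q *ᵥ (h + M *ᵥ m)) + ∑ k, v k * (Mᵀ * Q * M) k k := by
  have hS : ∀ i, MemLp (fun ω => (M *ᵥ Z ω) i) 2 ν := fun i => by
    simp only [mulVec, dotProduct]
    exact memLp_finsetSum _ fun k _ => (hL k).const_mul _
  have hT : ∀ i, MemLp (fun ω => (h + M *ᵥ Z ω) i) 2 ν := fun i =>
    (memLp_const (h i)).add (hS i)
  have hES : ∀ i, ∫ ω, (M *ᵥ Z ω) i ∂ν = (M *ᵥ m) i := fun i => by
    simp only [mulVec, dotProduct]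
    rw [integral_finsetSum _ fun k _ => ((hL k).const_mul _).integrable one_le_two]
    simp_rw [integral_const_mul, hm]
  have hET : ∀ i, ∫ ω, (h + M *ᵥ Z ω) i ∂ν = (h + M *ᵥ m) i := fun i => by
    simp only [Pi.add_apply]
    rw [integral_add (integrable_const _) ((hS i).integrable one_le_two), hES]
    simp
  have hcov : ∀ i j, covariance (fun ω => (h + M *ᵥ Z ω) i) (fun ω => (h + M *ᵥ Z ω) j) ν =
      ∑ k, v k * (M i k * M j k) := fun i j => by
    simp only [Pi.add_apply]
    rw [covariance_const_add_left ((hS i).integrable one_le_two),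
      covariance_const_add_right ((hS j).integrable one_le_two)]
    simp only [mulVec, dotProduct]
    rw [covariance_fun_sum_fun_sum (fun k => (hL k).const_mul _) (fun k => (hL k).const_mul _)]
    refine Finset.sum_congr rfl fun k _ => ?_
    simp_rw [covariance_const_mul_left, covariance_const_mul_right, hc]
    simp
    ring
  have hij : ∀ i j, ∫ ω, (h + M *ᵥ Z ω) i * (h + M *ᵥ Z ω) j ∂ν =
      (h + M *ᵥ m) i * (h + M *ᵥ m) j + ∑ k, v k * (M i k * M j k) := fun i j => by
    have := covariance_eq_sub (hT i) (hT j)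
    rw [hcov, hET, hET] at this
    have h2 : ν[(fun ω => (h + M *ᵥ Z ω) i) * fun ω => (h + M *ᵥ Z ω) j] =
      ∫ ω, (h + M *ᵥ Z ω) i * (h + M *ᵥ Z ω) j ∂ν := rfl
    linarith
  have hI : ∀ i j, Integrable (fun ω => (h + M *ᵥ Z ω) i * (h + M *ᵥ Z ω) j) ν := fun i j =>
    (hT i).integrable_mul (hT j)
  have hexp : ∀ t : n → ℝ, t ⬝ᵥ (Q *ᵥ t) = ∑ i, ∑ j, Q i j * (t i * t j) := fun t => by
    simp only [mulVec, dotProduct, Finset.mul_sum]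
    exact Finset.sum_congr rfl fun i _ => Finset.sum_congr rfl fun j _ => by ring
  simp_rw [hexp]
  refine ⟨integrable_finsetSum _ fun i _ => integrable_finsetSum _ fun j _ =>
    (hI i j).const_mul _, ?_⟩
  have hsum : ∫ ω, ∑ i, ∑ j, Q i j * ((h + M *ᵥ Z ω) i * (h + M *ᵥ Z ω) j) ∂ν =
      ∑ i, ∑ j, Q i j * ((h + M *ᵥ m) i * (h + M *ᵥ m) j + ∑ k, v k * (M i k * M j k)) := by
    refine (integral_finsetSum _ fun i _ => integrable_finsetSum _ fun j _ =>
      (hI i j).const_mul (Q i j)).trans (Finset.sum_congr rfl fun i _ => ?_)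
    refine (integral_finsetSum _ fun j _ => (hI i j).const_mul (Q i j)).trans
      (Finset.sum_congr rfl fun j _ => ?_)
    rw [integral_const_mul, hij]
  rw [hsum]
  simp_rw [mul_add, Finset.sum_add_distrib]
  congr 1
  have : ∀ k, (Mᵀ * Q * M) k k = ∑ i, ∑ j, Q i j * (M i k * M j k) := fun k => by
    rw [Matrix.mul_assoc]
    simp only [Matrix.mul_apply, transpose_apply, Finset.mul_sum]
    exact Finset.sum_congr rfl fun i _ => Finset.sum_congr rfl fun j _ => by ring
  simp_rw [this, Finset.mul_sum]
  conv_rhs => rw [Finset.sum_comm]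
  refine Finset.sum_congr rfl fun i _ => ?_
  rw [Finset.sum_comm]
  exact Finset.sum_congr rfl fun k _ => Finset.sum_congr rfl fun j _ => by ring

/-- The expected squared length of an affine image of a Gaussian vector with independent
components. -/
theorem integral_pi_gaussianReal {n ι : Type*} [Fintype n] [Fintype ι] [DecidableEq ι]
    [DecidableEq n] (m : ι → ℝ) (v : ι → NNReal) (a : n → ℝ) (V : Matrix n ι ℝ) :
    ∫ z, (a - V *ᵥ z) ⬝ᵥ (a - V *ᵥ z) ∂(Measure.pi fun k => gaussianReal (m k) (v k)) =
      (a - V *ᵥ m) ⬝ᵥ (a - V *ᵥ m) + ∑ k, (v k : ℝ) * (Vᵀ * V) k k := by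
  set ν := Measure.pi fun k => gaussianReal (m k) (v k) with hν
  have hL : ∀ k, MemLp (fun z : ι → ℝ => z k) 2 ν := fun k =>
    (memLp_id_gaussianReal' 2 (by simp)).comp_measurePreserving
      (measurePreserving_eval (fun k => gaussianReal (m k) (v k)) k)
  have hm : ∀ k, ∫ z, z k ∂ν = m k := fun k => by
    exact (integral_comp_eval (μ := fun k => gaussianReal (m k) (v k)) (i := k)
      (f := fun t : ℝ => t) (by fun_prop)).trans integral_id_gaussianReal
  have hc : ∀ k l, covariance (fun z : ι → ℝ => z k) (fun z => z l) ν =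
      if k = l then (v k : ℝ) else 0 := fun k l => by
    split_ifs with h
    · subst h
      rw [covariance_self (hL k).aestronglyMeasurable.aemeasurable]
      have h1 := variance_fun_id_gaussianReal (μ := m k) (v := v k)
      rwa [← (measurePreserving_eval (fun k => gaussianReal (m k) (v k)) k).map_eq,
        variance_map (by fun_prop)
          (measurable_pi_apply (X := fun _ => ℝ) k :
            Measurable (Function.eval k)).aemeasurable] at h1
    · exact ((iIndepFun_pi (μ := fun k => gaussianReal (m k) (v k))
        (X := fun _ t => t) (fun _ => by fun_prop)).indepFun h).covariance_eq_zero (hL k) (hL l)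
  have := (integral_quadForm hL hm hc (-V) 1 a).2
  simpa [neg_mulVec, ← sub_eq_add_neg] using this

theorem integral_encoder {rx ry rz : ℕ} (p : Params rx ry rz) (x a : Fin rx → ℝ)
    (V : Matrix (Fin rx) (Fin rz) ℝ) :
    ∫ z, (a - V *ᵥ z) ⬝ᵥ (a - V *ᵥ z) ∂(p.encoder x) =
      (a - V *ᵥ p.encMean x) ⬝ᵥ (a - V *ᵥ p.encMean x) + ∑ k, p.s k ^ 2 * (Vᵀ * V) k k :=
  integral_pi_gaussianReal (p.encMean x) (fun k => ⟨p.s k ^ 2, sq_nonneg _⟩) a V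

variable {Ω : Type*} [MeasurableSpace Ω] {μ : Measure Ω} [IsProbabilityMeasure μ]
  {rx ry ru rz : ℕ} {A : Matrix (Fin rx) (Fin ry) ℝ} {B : Matrix (Fin rx) (Fin ru) ℝ}
  {c : Fin rx → ℝ} {D : Matrix (Fin ry) (Fin rx) ℝ} {e : Fin ry → ℝ}
  {Y : Ω → Fin ry → ℝ} {U : Ω → Fin ru → ℝ}

/-- The expected quadratic form of `K Y + L U + h`; `(Y, U)` is a single random vector with mean
zero and identity covariance. -/
theorem IsAffineSurjectiveModel.integral_quadForm
    (hmodel : IsAffineSurjectiveModel μ A B c D e Y U) {n : Type*} [Fintype n]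
    (K : Matrix n (Fin ry) ℝ) (L : Matrix n (Fin ru) ℝ) (Q : Matrix n n ℝ) (h : n → ℝ) :
    Integrable (fun ω => (K *ᵥ Y ω + L *ᵥ U ω + h) ⬝ᵥ (Q *ᵥ (K *ᵥ Y ω + L *ᵥ U ω + h))) μ ∧
      ∫ ω, (K *ᵥ Y ω + L *ᵥ U ω + h) ⬝ᵥ (Q *ᵥ (K *ᵥ Y ω + L *ᵥ U ω + h)) ∂μ =
        h ⬝ᵥ (Q *ᵥ h) + (Kᵀ * Q * K).trace + (Lᵀ * Q * L).trace := by
  have hY : ∀ i, MemLp (fun ω => Y ω i) 2 μ := fun i => (memLp_pi_iff.1 hmodel.memLp_Y) i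
  have hU : ∀ i, MemLp (fun ω => U ω i) 2 μ := fun i => (memLp_pi_iff.1 hmodel.memLp_U) i
  have key := CycleCVAE.integral_quadForm (ν := μ) (Z := fun ω => Sum.elim (Y ω) (U ω)) (m := 0)
    (v := 1) (by rintro (k | k) <;> simp [hY, hU])
    (by rintro (k | k) <;> simp [hmodel.mean_Y, hmodel.mean_U])
    (by
      rintro (k | k) (l | l)
      · simpa using hmodel.cov_Y k l
      · simpa using hmodel.uncorrelated k l
      · simpa [covariance_comm] using hmodel.uncorrelated l k
      · simpa using hmodel.cov_U k l) (fromCols K L) Q h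
  have e1 : ∀ ω, h + fromCols K L *ᵥ Sum.elim (Y ω) (U ω) = K *ᵥ Y ω + L *ᵥ U ω + h := fun ω => by
    rw [fromCols_mulVec]; simp [add_comm]
  simp_rw [e1] at key
  refine ⟨key.1, key.2.trans ?_⟩
  simp [Fintype.sum_sum_type, trace, Matrix.mul_apply, fromCols, add_assoc]

end CycleCVAE

namespace CycleCVAE

variable {Ω : Type*} [MeasurableSpace Ω] {μ : Measure Ω}
  {rx ry ru rz : ℕ} {A : Matrix (Fin rx) (Fin ry) ℝ} {B : Matrix (Fin rx) (Fin ru) ℝ}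
  {c : Fin rx → ℝ} {D : Matrix (Fin ry) (Fin rx) ℝ} {e : Fin ry → ℝ}
  {Y : Ω → Fin ry → ℝ} {U : Ω → Fin ru → ℝ}

/-! ### Feasible parameters and the rank of the second-moment matrix -/

theorem groundTruth_mulVec {m : Type*} (W : Matrix m (Fin rx) ℝ) (y : Fin ry → ℝ)
    (u : Fin ru → ℝ) :
    W *ᵥ groundTruth A B c y u = (W * A) *ᵥ y + (W * B) *ᵥ u + W *ᵥ c := by
  simp [groundTruth, mulVec_add]

namespace IsAffineSurjectiveModel

theorem aemeasurable_affine (hmodel : IsAffineSurjectiveModel μ A B c D e Y U) {n : ℕ}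
    (K : Matrix (Fin n) (Fin ry) ℝ) (L : Matrix (Fin n) (Fin ru) ℝ) (h : Fin n → ℝ) :
    AEMeasurable (fun ω => K *ᵥ Y ω + L *ᵥ U ω + h) μ := by
  have hK : Continuous fun y : Fin ry → ℝ => K *ᵥ y := by fun_prop
  have hL : Continuous fun u : Fin ru → ℝ => L *ᵥ u := by fun_prop
  exact (((hK.comp_aestronglyMeasurable hmodel.memLp_Y.aestronglyMeasurable).add
    (hL.comp_aestronglyMeasurable hmodel.memLp_U.aestronglyMeasurable)).add
    aestronglyMeasurable_const).aemeasurable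

theorem aemeasurable_groundTruth (hmodel : IsAffineSurjectiveModel μ A B c D e Y U) :
    AEMeasurable (fun ω => groundTruth A B c (Y ω) (U ω)) μ :=
  hmodel.aemeasurable_affine A B c

variable [IsProbabilityMeasure μ]

theorem integral_affine (hmodel : IsAffineSurjectiveModel μ A B c D e Y U) {n : Type*} [Fintype n]
    (K : Matrix n (Fin ry) ℝ) (L : Matrix n (Fin ru) ℝ) (h : n → ℝ) (i : n) :
    ∫ ω, (K *ᵥ Y ω + L *ᵥ U ω + h) i ∂μ = h i := by
  have hY : ∀ k, Integrable (fun ω => Y ω k) μ := fun k =>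
    ((memLp_pi_iff.1 hmodel.memLp_Y) k).integrable one_le_two
  have hU : ∀ k, Integrable (fun ω => U ω k) μ := fun k =>
    ((memLp_pi_iff.1 hmodel.memLp_U) k).integrable one_le_two
  have h1 : Integrable (fun ω => ∑ k, K i k * Y ω k) μ :=
    integrable_finsetSum _ fun k _ => (hY k).const_mul _
  have h2 : Integrable (fun ω => ∑ k, L i k * U ω k) μ :=
    integrable_finsetSum _ fun k _ => (hU k).const_mul _
  have e1 : ∫ ω, ∑ k, K i k * Y ω k ∂μ = 0 := by
    rw [integral_finsetSum _ fun k _ => (hY k).const_mul _]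
    simp [integral_const_mul, hmodel.mean_Y]
  have e2 : ∫ ω, ∑ k, L i k * U ω k ∂μ = 0 := by
    rw [integral_finsetSum _ fun k _ => (hU k).const_mul _]
    simp [integral_const_mul, hmodel.mean_U]
  have e3 := integral_add (h1.add h2) (integrable_const (h i))
  have e4 := integral_add h1 h2
  simp only [Pi.add_apply, integral_const, probReal_univ, one_smul] at e3
  rw [e4, e1, e2, zero_add, zero_add] at e3
  exact e3

/-- The constraint that `ŷ` has the law of `y` pins down `ŷ` on the data space: comparing means
gives the bias, and the identifiability assumption gives the rest. -/
theorem mem_feasible_iff (hmodel : IsAffineSurjectiveModel μ A B c D e Y U)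
    (p : Params rx ry rz) :
    p ∈ Params.feasible rz (lawX μ A B c Y U) (μ.map Y) ↔
      (∀ k, p.s k ≠ 0) ∧ p.Wy * A = 1 ∧ p.Wy * B = 0 ∧ p.bY = -(p.Wy *ᵥ c) := by
  have hc : Continuous p.yhat := by unfold Params.yhat; fun_prop
  have hmap : (lawX μ A B c Y U).map p.yhat =
      μ.map fun ω => (p.Wy * A) *ᵥ Y ω + (p.Wy * B) *ᵥ U ω + (p.Wy *ᵥ c + p.bY) := by
    unfold lawX
    rw [AEMeasurable.map_map_of_aemeasurable hc.measurable.aemeasurable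
      hmodel.aemeasurable_groundTruth]
    congr 1
    funext ω
    simp only [Function.comp, Params.yhat, groundTruth_mulVec, add_assoc]
  have hYm := hmodel.memLp_Y.aestronglyMeasurable.aemeasurable
  unfold Params.feasible
  simp only [mem_ofPred_eq, hmap]
  refine and_congr_right fun _ => ⟨fun h => ?_, fun ⟨h1, h2, h3⟩ => ?_⟩
  · have hb : p.Wy *ᵥ c + p.bY = 0 := by
      funext i
      have hm := hmodel.aemeasurable_affine (p.Wy * A) (p.Wy * B) (p.Wy *ᵥ c + p.bY)
      have hi : Continuous fun y : Fin ry → ℝ => y i := continuous_apply i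
      have := congrArg (fun ν => ∫ y : Fin ry → ℝ, y i ∂ν) h
      beta_reduce at this
      rw [integral_map hm hi.aestronglyMeasurable, integral_map hYm hi.aestronglyMeasurable,
        hmodel.integral_affine, hmodel.mean_Y] at this
      exact this
    simp only [hb, add_zero] at h
    obtain ⟨h1, h2⟩ := (hmodel.identifiable _ _).1 h
    exact ⟨h1, h2, by rw [eq_neg_iff_add_eq_zero, add_comm]; exact hb⟩
  · simp [h1, h2, h3]

/-- On the data space a feasible `ŷ` recovers `y`. -/
theorem yhat_groundTruth {p : Params rx ry rz} (h1 : p.Wy * A = 1) (h2 : p.Wy * B = 0)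
    (h3 : p.bY = -(p.Wy *ᵥ c)) (y : Fin ry → ℝ) (u : Fin ru → ℝ) :
    p.yhat (groundTruth A B c y u) = y := by
  simp [Params.yhat, groundTruth_mulVec, h1, h2, h3]

theorem secondMoment_lawX (hmodel : IsAffineSurjectiveModel μ A B c D e Y U) :
    secondMoment (lawX μ A B c Y U) = A * Aᵀ + B * Bᵀ + vecMulVec c c := by
  ext i j
  simp only [secondMoment, of_apply, lawX]
  rw [integral_map hmodel.aemeasurable_groundTruth
    (by fun_prop : Continuous fun x : Fin rx → ℝ => x i * x j).aestronglyMeasurable]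
  have := (hmodel.integral_quadForm A B (Matrix.single i j (1 : ℝ)) c).2
  simp only [groundTruth]
  have e1 : ∀ x : Fin rx → ℝ, x ⬝ᵥ (Matrix.single i j (1 : ℝ) *ᵥ x) = x i * x j := fun x => by
    simp [single_mulVec, dotProduct, Function.update_apply]
  simp_rw [e1] at this
  rw [this]
  have e2 : ∀ {k : ℕ} (K : Matrix (Fin rx) (Fin k) ℝ),
      (Kᵀ * Matrix.single i j (1 : ℝ) * K).trace = (K * Kᵀ) i j := fun K => by
    rw [trace_mul_cycle, trace_mul_comm]
    simp [trace_single_mul, Matrix.mul_apply, mul_comm]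
  simp only [e2, Matrix.add_apply, vecMulVec_apply]
  ring

/-- The column spaces of `A` and `B` are independent because `D` is a left inverse of `A` and kills
`B`. -/
theorem finrank_range_sup (hA : D * A = 1) (hB : D * B = 0) :
    Module.finrank ℝ (LinearMap.range A.mulVecLin ⊔ LinearMap.range B.mulVecLin : Submodule ℝ _) =
      ry + B.rank := by
  have hdis : LinearMap.range A.mulVecLin ⊓ LinearMap.range B.mulVecLin = ⊥ := by
    rw [eq_bot_iff]
    rintro x ⟨⟨y, rfl⟩, ⟨u, hu⟩⟩
    have h := congrArg (D *ᵥ ·) hu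
    simp only [mulVecLin_apply, mulVec_mulVec, hA, hB, zero_mulVec, one_mulVec] at h
    simp [← h]
  have hinj : Function.Injective A.mulVecLin := fun y y' h => by
    have h := congrArg (D *ᵥ ·) h
    simpa [mulVec_mulVec, hA] using h
  have h := Submodule.finrank_sup_add_finrank_inf_eq (LinearMap.range A.mulVecLin)
    (LinearMap.range B.mulVecLin)
  rw [hdis, finrank_bot, add_zero] at h
  rw [h, LinearMap.finrank_range_of_inj hinj]
  simp [Matrix.rank]

theorem add_rank_le_rank_secondMoment (hmodel : IsAffineSurjectiveModel μ A B c D e Y U) :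
    ry + B.rank ≤ (secondMoment (lawX μ A B c Y U)).rank := by
  have h : secondMoment (lawX μ A B c Y U) =
      fromCols (fromCols A B) (replicateCol Unit c) *
        (fromCols (fromCols A B) (replicateCol Unit c))ᵀ := by
    rw [hmodel.secondMoment_lawX, transpose_fromCols, fromCols_mul_fromRows, transpose_fromCols,
      fromCols_mul_fromRows]
    ext i j
    simp [vecMulVec_apply, Matrix.mul_apply]
  rw [h, rank_self_mul_transpose, ← finrank_range_sup hmodel.D_mul_A hmodel.D_mul_B, Matrix.rank]
  refine Submodule.finrank_mono (sup_le ?_ ?_)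
  · rintro _ ⟨y, rfl⟩
    exact ⟨Sum.elim (Sum.elim y 0) 0, by simp [fromCols_mulVec]⟩
  · rintro _ ⟨u, rfl⟩
    exact ⟨Sum.elim (Sum.elim 0 u) 0, by simp [fromCols_mulVec]⟩

end IsAffineSurjectiveModel

variable [IsProbabilityMeasure μ]

/-! ### The loss as an explicit function of the parameters -/

/-- The Frobenius inner product of two real matrices. -/
noncomputable def frob {m n : Type*} [Fintype m] [Fintype n] (X Z : Matrix m n ℝ) : ℝ :=
  (Xᵀ * Z).trace

theorem IsAffineSurjectiveModel.lossX_eq (hmodel : IsAffineSurjectiveModel μ A B c D e Y U)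
    (γ : ℝ) {p : Params rx ry rz} (h1 : p.Wy * A = 1) (h2 : p.Wy * B = 0)
    (h3 : p.bY = -(p.Wy *ᵥ c)) :
    p.lossX (lawX μ A B c Y U) γ =
      (1 / γ) * (frob (A - p.Wx - p.Vx * (p.Wz * A)) (A - p.Wx - p.Vx * (p.Wz * A)) +
        frob (B - p.Vx * (p.Wz * B)) (B - p.Vx * (p.Wz * B)) +
        (c - p.bx - p.Vx *ᵥ p.encMean c) ⬝ᵥ (c - p.bx - p.Vx *ᵥ p.encMean c) +
        ∑ k, p.s k ^ 2 * (p.Vxᵀ * p.Vx) k k) + rx * Real.log γ +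
      ∑ k, (p.s k ^ 2 - Real.log (p.s k ^ 2)) +
      (frob (p.Wz * A) (p.Wz * A) + frob (p.Wz * B) (p.Wz * B) +
        p.encMean c ⬝ᵥ p.encMean c) := by
  have hin : ∀ x, ∫ z, (1 / γ) *
      ((x - p.decode (p.yhat x) z) ⬝ᵥ (x - p.decode (p.yhat x) z)) ∂(p.encoder x) =
      (1 / γ) * ((x - p.Wx *ᵥ p.yhat x - p.bx - p.Vx *ᵥ p.encMean x) ⬝ᵥ
        (x - p.Wx *ᵥ p.yhat x - p.bx - p.Vx *ᵥ p.encMean x) +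
        ∑ k, p.s k ^ 2 * (p.Vxᵀ * p.Vx) k k) := fun x => by
    rw [integral_const_mul, ← integral_encoder]
    congr 2
    funext z
    have : x - p.decode (p.yhat x) z = x - p.Wx *ᵥ p.yhat x - p.bx - p.Vx *ᵥ z := by
      simp only [Params.decode]; abel
    rw [this]
  unfold Params.lossX lawX
  simp_rw [hin]
  rw [integral_map hmodel.aemeasurable_groundTruth (Continuous.aestronglyMeasurable
    (by unfold Params.yhat Params.encMean; fun_prop))]
  have eT : ∀ ω, groundTruth A B c (Y ω) (U ω) -
      p.Wx *ᵥ p.yhat (groundTruth A B c (Y ω) (U ω)) - p.bx -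
      p.Vx *ᵥ p.encMean (groundTruth A B c (Y ω) (U ω)) =
      (A - p.Wx - p.Vx * (p.Wz * A)) *ᵥ Y ω + (B - p.Vx * (p.Wz * B)) *ᵥ U ω +
        (c - p.bx - p.Vx *ᵥ p.encMean c) := fun ω => by
    rw [IsAffineSurjectiveModel.yhat_groundTruth h1 h2 h3]
    simp only [Params.encMean, groundTruth_mulVec, mulVec_add, sub_mulVec, ← mulVec_mulVec]
    simp only [groundTruth]
    abel
  have eM : ∀ ω, p.encMean (groundTruth A B c (Y ω) (U ω)) =
      (p.Wz * A) *ᵥ Y ω + (p.Wz * B) *ᵥ U ω + p.encMean c := fun ω => by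
    simp only [Params.encMean, groundTruth_mulVec]
    abel
  simp_rw [eT, eM]
  have q1 := hmodel.integral_quadForm (A - p.Wx - p.Vx * (p.Wz * A)) (B - p.Vx * (p.Wz * B)) 1
    (c - p.bx - p.Vx *ᵥ p.encMean c)
  have q2 := hmodel.integral_quadForm (p.Wz * A) (p.Wz * B) 1 (p.encMean c)
  simp only [one_mulVec, Matrix.mul_one] at q1 q2
  rw [integral_add, integral_add, integral_add, integral_const_mul, integral_add, q1.2, q2.2]
  · simp only [integral_const, probReal_univ, one_smul, frob]
    ring
  · exact q1.1
  · exact integrable_const _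
  · exact (q1.1.add (integrable_const _)).const_mul _
  · exact integrable_const _
  · exact ((q1.1.add (integrable_const _)).const_mul _).add (integrable_const _)
  · exact integrable_const _
  · exact (((q1.1.add (integrable_const _)).const_mul _).add (integrable_const _)).add
      (integrable_const _)
  · exact q2.1

theorem IsAffineSurjectiveModel.lossY_eq (hmodel : IsAffineSurjectiveModel μ A B c D e Y U)
    (γ : ℝ) {p : Params rx ry rz} (h1 : p.Wy * A = 1) (h3 : p.bY = -(p.Wy *ᵥ c)) :
    p.lossY (μ.map Y) γ =
      ((p.Wy * (A - p.Wx))ᵀ * (p.covY γ)⁻¹ * (p.Wy * (A - p.Wx))).trace +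
      (p.Wy *ᵥ (c - p.bx)) ⬝ᵥ ((p.covY γ)⁻¹ *ᵥ (p.Wy *ᵥ (c - p.bx))) +
      Real.log (p.covY γ).det := by
  have hr : ∀ y, p.residualY y = (p.Wy * (A - p.Wx)) *ᵥ y + p.Wy *ᵥ (c - p.bx) := fun y => by
    rw [Matrix.mul_sub, h1]
    simp only [Params.residualY, Params.yhat, Params.decode, h3, sub_mulVec,
      mulVec_add, mulVec_sub, mulVec_zero, one_mulVec, ← mulVec_mulVec]
    abel
  unfold Params.lossY
  rw [integral_map hmodel.memLp_Y.aestronglyMeasurable.aemeasurable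
    (Continuous.aestronglyMeasurable
      (by unfold Params.residualY Params.yhat Params.decode; fun_prop))]
  have q := hmodel.integral_quadForm (p.Wy * (A - p.Wx)) 0 (p.covY γ)⁻¹ (p.Wy *ᵥ (c - p.bx))
  simp only [zero_mulVec, add_zero, ← hr] at q
  rw [integral_add q.1 (integrable_const _), q.2]
  simp
  ring

end CycleCVAE

namespace CycleCVAE

/-! ### Linear algebra -/

section Frobenius

variable {m n l : Type*} [Fintype m]

theorem transpose_mul_self_apply_nonneg (X : Matrix m n ℝ) (k : n) : 0 ≤ (Xᵀ * X) k k :=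
  Finset.sum_nonneg fun _ _ => mul_self_nonneg _

theorem transpose_mul_self_apply_eq_zero {X : Matrix m n ℝ} {k : n} :
    (Xᵀ * X) k k = 0 ↔ X.col k = 0 := by
  refine (Finset.sum_eq_zero_iff_of_nonneg fun i _ => mul_self_nonneg (X i k)).trans ?_
  simp [funext_iff]

variable [Fintype n] [Fintype l]

theorem frob_comm (X Z : Matrix m n ℝ) : frob X Z = frob Z X := by
  unfold frob
  rw [← trace_transpose, transpose_mul, transpose_transpose]

theorem frob_add_left (X Z W : Matrix m n ℝ) : frob (X + Z) W = frob X W + frob Z W := by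
  simp [frob, Matrix.add_mul]

theorem frob_add_right (X Z W : Matrix m n ℝ) : frob X (Z + W) = frob X Z + frob X W := by
  simp [frob, Matrix.mul_add]

theorem frob_smul_left (t : ℝ) (X Z : Matrix m n ℝ) : frob (t • X) Z = t * frob X Z := by
  simp [frob]

theorem frob_smul_right (t : ℝ) (X Z : Matrix m n ℝ) : frob X (t • Z) = t * frob X Z := by
  simp [frob]

theorem frob_sub_right (X Z W : Matrix m n ℝ) : frob X (Z - W) = frob X Z - frob X W := by
  simp [frob, Matrix.mul_sub]

theorem frob_add_smul_self (X Z : Matrix m n ℝ) (t : ℝ) :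
    frob (X + t • Z) (X + t • Z) = frob X X + 2 * t * frob X Z + t ^ 2 * frob Z Z := by
  simp only [frob_add_left, frob_add_right, frob_smul_left, frob_smul_right, frob_comm Z X]
  ring

theorem frob_mul_left (X : Matrix m l ℝ) (Z : Matrix l n ℝ) (W : Matrix m n ℝ) :
    frob (X * Z) W = frob Z (Xᵀ * W) := by
  simp [frob, Matrix.mul_assoc]

theorem frob_mul_right (X : Matrix m l ℝ) (Z : Matrix l n ℝ) (W : Matrix m n ℝ) :
    frob (X * Z) W = frob X (W * Zᵀ) := by
  unfold frob
  rw [transpose_mul, Matrix.mul_assoc, trace_mul_comm, Matrix.mul_assoc]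

theorem frob_self_nonneg (X : Matrix m n ℝ) : 0 ≤ frob X X :=
  Finset.sum_nonneg fun _ _ => Finset.sum_nonneg fun _ _ => mul_self_nonneg _

theorem frob_self_eq_zero {X : Matrix m n ℝ} : frob X X = 0 ↔ X = 0 := by
  have := trace_conjTranspose_mul_self_eq_zero_iff (A := X)
  rwa [conjTranspose_eq_transpose_of_trivial] at this

/-- The weighted sum of the squared column lengths is a Frobenius product. -/
theorem sum_mul_transpose_mul_self [DecidableEq n] (w : n → ℝ) (X Z : Matrix m n ℝ) :
    ∑ k, w k * (Xᵀ * Z) k k = frob (X * Matrix.diagonal w) Z := by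
  simp [frob, trace, Matrix.mul_assoc]

end Frobenius

/-- The normal equations `Bᵀ B X = Bᵀ` are solvable; `B X` is then the orthogonal projection onto
the column space of `B`. -/
theorem exists_normal_equation {m n : Type*} [Fintype m] [Fintype n] [DecidableEq m]
    [DecidableEq n] (B : Matrix m n ℝ) : ∃ X : Matrix n m ℝ, Bᵀ * B * X = Bᵀ := by
  have hle : LinearMap.range (Bᵀ * B).mulVecLin ≤ LinearMap.range Bᵀ.mulVecLin := by
    rintro _ ⟨u, rfl⟩
    exact ⟨B *ᵥ u, by simp⟩
  have heq := Submodule.eq_of_le_of_finrank_eq hle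
    (by
      have h := rank_transpose_mul_self B
      rw [← rank_transpose B] at h
      exact h)
  have : ∀ j, ∃ u, (Bᵀ * B) *ᵥ u = Bᵀ.col j := fun j => by
    have hj : Bᵀ.col j ∈ LinearMap.range (Bᵀ * B).mulVecLin := by
      rw [heq]
      exact ⟨Pi.single j 1, by simp⟩
    exact hj
  choose f hf using this
  refine ⟨(Matrix.of f)ᵀ, ?_⟩
  ext i j
  exact congrFun (hf j) i

/-- The columns of `W` lie in the column space of `V` as soon as the column space of `W` is
contained in that of `V`. -/
theorem exists_mul_eq_of_range_le {m n l : Type*} [Fintype n] [Fintype l] [DecidableEq l]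
    {V : Matrix m n ℝ} {W : Matrix m l ℝ}
    (h : LinearMap.range W.mulVecLin ≤ LinearMap.range V.mulVecLin) : 
    ∃ X : Matrix n l ℝ, V * X = W := by
  have : ∀ j, ∃ u, V *ᵥ u = W.col j := fun j => by
    simpa using h ⟨Pi.single j 1, by simp⟩
  choose f hf using this
  refine ⟨(Matrix.of f)ᵀ, ?_⟩
  ext i j
  exact congrFun (hf j) i

/-- On the column space of `B`, the quadratic form of `B Bᵀ` is bounded below. -/
theorem exists_lower_bound {m n : Type*} [Fintype m] [Fintype n] (B : Matrix m n ℝ) :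
    ∃ δ : ℝ, 0 < δ ∧ ∀ u, δ * ((B *ᵥ u) ⬝ᵥ (B *ᵥ u)) ≤
      (Bᵀ *ᵥ (B *ᵥ u)) ⬝ᵥ (Bᵀ *ᵥ (B *ᵥ u)) := by
  classical
  -- a left inverse of `Bᵀ` on the column space of `B` has a finite Frobenius norm
  obtain ⟨X, hX⟩ := exists_normal_equation B
  refine ⟨(1 + frob X X)⁻¹, inv_pos.2 (by linarith [frob_self_nonneg X]), fun u => ?_⟩
  rw [inv_mul_le_iff₀ (by linarith [frob_self_nonneg X])]
  have hw : B *ᵥ u = Xᵀ *ᵥ (Bᵀ *ᵥ (B *ᵥ u)) := by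
    have h := congrArg transpose hX
    simp only [transpose_mul, transpose_transpose] at h
    rw [mulVec_mulVec, mulVec_mulVec, Matrix.mul_assoc, h]
  set y := Bᵀ *ᵥ (B *ᵥ u) with hy
  have hcs : (Xᵀ *ᵥ y) ⬝ᵥ (Xᵀ *ᵥ y) ≤ frob X X * (y ⬝ᵥ y) := by
    have : frob X X = ∑ i, ∑ k, X k i * X k i := rfl
    rw [this, Finset.sum_mul]
    refine Finset.sum_le_sum fun i _ => ?_
    have := Finset.sum_mul_sq_le_sq_mul_sq Finset.univ (fun k => X k i) y
    simp only [mulVec, dotProduct, transpose_apply] at this ⊢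
    simpa only [sq] using this
  have hyy : 0 ≤ y ⬝ᵥ y := Finset.sum_nonneg fun _ _ => mul_self_nonneg _
  rw [hw]
  linarith

theorem det_smul_one_add_smul {n : Type*} [Fintype n] [DecidableEq n] {S : Matrix n n ℝ}
    (hS : S.IsHermitian) (γ a : ℝ) :
    (γ • (1 : Matrix n n ℝ) + a • S).det = ∏ i, (γ + a * hS.eigenvalues i) := by
  have h : γ • (1 : Matrix n n ℝ) + a • S = Unitary.conjStarAlgAut ℝ _ hS.eigenvectorUnitary
      (Matrix.diagonal fun i => γ + a * hS.eigenvalues i) := by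
    have hd : (Matrix.diagonal fun i => γ + a * hS.eigenvalues i) =
        γ • (1 : Matrix n n ℝ) + a • Matrix.diagonal (RCLike.ofReal ∘ hS.eigenvalues) := by
      ext i j
      by_cases hij : i = j <;> simp [hij]
    rw [hd, map_add, map_smul, map_smul, map_one, ← hS.spectral_theorem]
  rw [h, Unitary.conjStarAlgAut_apply, det_mul_right_comm, det_mul]
  simp

theorem posDef_smul_one_add {n k : Type*} [Fintype n] [DecidableEq n] [Fintype k] {γ : ℝ}
    (hγ : 0 < γ) (M : Matrix n k ℝ) : (γ • (1 : Matrix n n ℝ) + M * Mᵀ).PosDef := by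
  have h := posSemidef_self_mul_conjTranspose M
  rw [conjTranspose_eq_transpose_of_trivial] at h
  exact (PosDef.one.smul hγ).add_posSemidef h

/-- Shrinking `M` does not increase the log-determinant of `γ I + M Mᵀ`. -/
theorem log_det_smul_le {n k : Type*} [Fintype n] [DecidableEq n] [Fintype k] {γ a : ℝ}
    (hγ : 0 < γ) (ha : a ^ 2 ≤ 1) (M : Matrix n k ℝ) :
    Real.log (γ • (1 : Matrix n n ℝ) + (a • M) * (a • M)ᵀ).det ≤
      Real.log (γ • (1 : Matrix n n ℝ) + M * Mᵀ).det := by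
  refine Real.log_le_log (posDef_smul_one_add hγ _).det_pos ?_
  have hS := posSemidef_self_mul_conjTranspose M
  rw [conjTranspose_eq_transpose_of_trivial] at hS
  have h1 := det_smul_one_add_smul hS.1 γ 1
  have h2 := det_smul_one_add_smul hS.1 γ (a ^ 2)
  rw [one_smul] at h1
  rw [transpose_smul, Matrix.smul_mul, Matrix.mul_smul, smul_smul, ← sq, h1, h2]
  refine Finset.prod_le_prod (fun i _ => ?_) fun i _ => ?_
  · have := hS.eigenvalues_nonneg i
    positivity
  · have := mul_le_mul_of_nonneg_right ha (hS.eigenvalues_nonneg i)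
    linarith

/-! ### Planar rotations -/

section Rotation

variable {n : Type*} [DecidableEq n]

/-- The rotation by the angle `t` in the plane of the coordinates `i` and `j`. -/
noncomputable def planeRotation (i j : n) (t : ℝ) : Matrix n n ℝ :=
  1 + (Real.cos t - 1) • (Matrix.single i i 1 + Matrix.single j j 1) +
    Real.sin t • (Matrix.single j i 1 - Matrix.single i j 1)

theorem planeRotation_zero (i j : n) : planeRotation i j 0 = 1 := by
  simp [planeRotation]

theorem continuous_planeRotation (i j : n) : Continuous (planeRotation i j) := by
  unfold planeRotation
  fun_prop

variable [Fintype n]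

theorem planeRotation_mul_transpose {i j : n} (hij : i ≠ j) (t : ℝ) :
    planeRotation i j t * (planeRotation i j t)ᵀ = 1 := by
  set P : Matrix n n ℝ := Matrix.single i i 1 + Matrix.single j j 1 with hP
  set K : Matrix n n ℝ := Matrix.single j i 1 - Matrix.single i j 1 with hK
  have hPP : P * P = P := by
    simp [hP, Matrix.add_mul, Matrix.mul_add, hij, hij.symm]
  have hKK : K * K = -P := by
    simp [hP, hK, Matrix.sub_mul, Matrix.mul_sub, hij, hij.symm]
    abel
  have hPK : P * K = K := by
    simp [hP, hK, Matrix.add_mul, Matrix.mul_sub, hij, hij.symm]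
  have hKP : K * P = K := by
    simp [hP, hK, Matrix.sub_mul, Matrix.mul_add, hij, hij.symm]
    abel
  have hPt : Pᵀ = P := by simp [hP]
  have hKt : Kᵀ = -K := by simp [hK]
  have h1 := Real.sin_sq_add_cos_sq t
  have h : planeRotation i j t = 1 + (Real.cos t - 1) • P + Real.sin t • K := rfl
  rw [h]
  simp only [transpose_add, transpose_smul, transpose_one, hPt, hKt, Matrix.add_mul,
    Matrix.mul_add, Matrix.one_mul, Matrix.mul_one, Matrix.smul_mul, Matrix.mul_smul, hPP, hKP,
    hPK, hKK, Matrix.mul_neg, smul_neg]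
  have : Real.sin t * Real.sin t = 1 - Real.cos t * Real.cos t := by nlinarith
  match_scalars <;> linarith

variable {m : Type*}

theorem col_mul_planeRotation_left {i j : n} (hij : i ≠ j) (V : Matrix m n ℝ) (t : ℝ) :
    (V * planeRotation i j t).col i = Real.cos t • V.col i + Real.sin t • V.col j := by
  ext a
  simp [planeRotation, Matrix.mul_add, Matrix.mul_sub, Matrix.mul_smul, hij]
  ring

theorem col_mul_planeRotation_right {i j : n} (hij : i ≠ j) (V : Matrix m n ℝ) (t : ℝ) :
    (V * planeRotation i j t).col j = Real.cos t • V.col j - Real.sin t • V.col i := by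
  ext a
  simp [planeRotation, Matrix.mul_add, Matrix.mul_sub, Matrix.mul_smul, hij.symm]
  ring

theorem col_mul_planeRotation_of_ne {i j k : n} (hi : k ≠ i) (hj : k ≠ j) (V : Matrix m n ℝ)
    (t : ℝ) : (V * planeRotation i j t).col k = V.col k := by
  ext a
  simp [planeRotation, Matrix.mul_add, Matrix.mul_sub, Matrix.mul_smul, hi, hj]

/-- A small rotation of a symmetric `2 × 2` matrix with diagonal `a`, `b` and off-diagonal entry
`g ≠ 0`, in the right direction, decreases the product of the diagonal entries: the sum `a + b` is
invariant and the gap `|a - b|` grows. -/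
theorem exists_rotation_mul_lt (a b : ℝ) {g : ℝ} (hg : g ≠ 0) :
    ∃ ε : ℝ, (ε = 1 ∨ ε = -1) ∧ ∀ᶠ t in 𝓝[>] (0 : ℝ),
      (Real.cos (ε * t) ^ 2 * a + Real.sin (ε * t) ^ 2 * b +
          2 * Real.cos (ε * t) * Real.sin (ε * t) * g) *
        (Real.sin (ε * t) ^ 2 * a + Real.cos (ε * t) ^ 2 * b -
          2 * Real.cos (ε * t) * Real.sin (ε * t) * g) < a * b := by
  obtain ⟨ε, hε, hεg⟩ : ∃ ε : ℝ, (ε = 1 ∨ ε = -1) ∧ 0 ≤ ε * (g * (a - b)) := by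
    rcases le_total 0 (g * (a - b)) with h | h
    · exact ⟨1, Or.inl rfl, by linarith⟩
    · exact ⟨-1, Or.inr rfl, by linarith⟩
  have hεε : ε ^ 2 = 1 := by rcases hε with rfl | rfl <;> norm_num
  refine ⟨ε, hε, ?_⟩
  have key : ∀ t, a * b - (Real.cos (ε * t) ^ 2 * a + Real.sin (ε * t) ^ 2 * b +
          2 * Real.cos (ε * t) * Real.sin (ε * t) * g) *
        (Real.sin (ε * t) ^ 2 * a + Real.cos (ε * t) ^ 2 * b -
          2 * Real.cos (ε * t) * Real.sin (ε * t) * g) =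
      Real.sin t * Real.cos t * (Real.cos t * Real.sin t * (4 * g ^ 2 - (a - b) ^ 2) +
        2 * (Real.cos t ^ 2 - Real.sin t ^ 2) * (ε * (g * (a - b)))) := fun t => by
    have h1 := Real.cos_sq_add_sin_sq t
    have h2 : Real.cos (ε * t) = Real.cos t := by rcases hε with rfl | rfl <;> simp
    have h3 : Real.sin (ε * t) = ε * Real.sin t := by rcases hε with rfl | rfl <;> simp
    rw [h2, h3]
    have h4 : a * b = a * b * (Real.cos t ^ 2 + Real.sin t ^ 2) ^ 2 := by rw [h1]; ring
    rw [h4]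
    linear_combination (a ^ 2 * Real.cos t ^ 2 * Real.sin t ^ 2 * (-1) -
      b ^ 2 * Real.cos t ^ 2 * Real.sin t ^ 2 - a * b * Real.sin t ^ 4 * (ε ^ 2 + 1) +
      4 * g ^ 2 * Real.cos t ^ 2 * Real.sin t ^ 2 +
      (-2) * ε * g * Real.cos t * Real.sin t ^ 3 * (a - b)) * hεε
  have hsin : ∀ᶠ t in 𝓝[>] (0 : ℝ), 0 < Real.sin t ∧ 0 < Real.cos t := by
    filter_upwards [Ioo_mem_nhdsGT (show (0 : ℝ) < 1 by norm_num)] with t ht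
    have := Real.pi_gt_three
    exact ⟨Real.sin_pos_of_pos_of_lt_pi ht.1 (by linarith [ht.2]),
      Real.cos_pos_of_mem_Ioo ⟨by linarith [ht.1], by linarith [ht.2]⟩⟩
  have hbr : ∀ᶠ t in 𝓝[>] (0 : ℝ), 0 < Real.cos t * Real.sin t * (4 * g ^ 2 - (a - b) ^ 2) +
      2 * (Real.cos t ^ 2 - Real.sin t ^ 2) * (ε * (g * (a - b))) := by
    rcases hεg.eq_or_lt with h0 | hpos
    · have hab : a - b = 0 := by
        have hε0 : ε ≠ 0 := by rintro rfl; norm_num at hεε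
        simpa [hε0, hg] using h0.symm
      filter_upwards [hsin] with t ht
      rw [hab]
      have := mul_pos ht.2 ht.1
      have := mul_pos this (pow_pos (abs_pos.2 hg) 2)
      rw [sq_abs] at this
      nlinarith
    · have hcont : Continuous fun t => Real.cos t * Real.sin t * (4 * g ^ 2 - (a - b) ^ 2) +
          2 * (Real.cos t ^ 2 - Real.sin t ^ 2) * (ε * (g * (a - b))) := by fun_prop
      refine nhdsWithin_le_nhds ((hcont.tendsto 0).eventually_const_lt ?_)
      simpa using hpos
  filter_upwards [hsin, hbr] with t ht hb
  have := mul_pos (mul_pos ht.1 ht.2) hb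
  rw [← key] at this
  linarith

end Rotation

theorem nonpos_of_eventually_le_pow_mul {a b : ℝ} {k : ℕ} (hk : k ≠ 0)
    (h : ∀ᶠ t in 𝓝[>] (0 : ℝ), a ≤ t ^ k * b) : a ≤ 0 := by
  have hlim : Tendsto (fun t : ℝ => t ^ k * b) (𝓝[>] 0) (𝓝 (0 ^ k * b)) :=
    ((by fun_prop : Continuous fun t : ℝ => t ^ k * b).tendsto 0).mono_left nhdsWithin_le_nhds
  rw [zero_pow hk, zero_mul] at hlim
  exact ge_of_tendsto hlim h

end CycleCVAE

namespace CycleCVAE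

variable {Ω : Type*} [MeasurableSpace Ω] {μ : Measure Ω} [IsProbabilityMeasure μ]
  {rx ry ru rz : ℕ} {A : Matrix (Fin rx) (Fin ry) ℝ} {B : Matrix (Fin rx) (Fin ru) ℝ}
  {c : Fin rx → ℝ} {D : Matrix (Fin ry) (Fin rx) ℝ} {e : Fin ry → ℝ}
  {Y : Ω → Fin ry → ℝ} {U : Ω → Fin ru → ℝ}

/-! ### Reduction to the decoder weight of the latent variable -/

theorem eventually_le_of_isLocalMinOn {α : Type*} [TopologicalSpace α] {f : α → ℝ} {S : Set α}
    {x : α} (h : IsLocalMinOn f S x) {g : ℝ → α} (hg : ContinuousAt g 0) (hg0 : g 0 = x)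
    (hS : ∀ᶠ t in 𝓝[>] (0 : ℝ), g t ∈ S) : ∀ᶠ t in 𝓝[>] (0 : ℝ), f x ≤ f (g t) := by
  subst hg0
  exact (tendsto_nhdsWithin_iff.2 ⟨hg.tendsto.mono_left nhdsWithin_le_nhds, hS⟩).eventually h

/-- The part of the loss that depends on `V_x`, `N = W_z B` and `s` once the other parameters have
their optimal values, up to the constant `r_x log γ`. -/
noncomputable def reducedLoss (γ : ℝ) (B : Matrix (Fin rx) (Fin ru) ℝ)
    (Wy : Matrix (Fin ry) (Fin rx) ℝ) (V : Matrix (Fin rx) (Fin rz) ℝ)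
    (N : Matrix (Fin rz) (Fin ru) ℝ) (s : Fin rz → ℝ) : ℝ :=
  (1 / γ) * (frob (B - V * N) (B - V * N) + ∑ k, s k ^ 2 * (Vᵀ * V) k k) +
    ∑ k, (s k ^ 2 - Real.log (s k ^ 2)) + frob N N +
    Real.log (γ • (1 : Matrix (Fin ry) (Fin ry) ℝ) + (Wy * V) * (Wy * V)ᵀ).det

/-- Local minimality of `reducedLoss` in `(V_x, W_z, s)` over the encoders that ignore the
`A`-directions. -/
structure IsReducedMinimum (γ : ℝ) (A : Matrix (Fin rx) (Fin ry) ℝ)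
    (B : Matrix (Fin rx) (Fin ru) ℝ) (Wy : Matrix (Fin ry) (Fin rx) ℝ)
    (V : Matrix (Fin rx) (Fin rz) ℝ) (Z : Matrix (Fin rz) (Fin rx) ℝ) (s : Fin rz → ℝ) :
    Prop where
  Z_mul_A : Z * A = 0
  s_ne_zero : ∀ k, s k ≠ 0
  isLocalMinOn : IsLocalMinOn
    (fun w : Matrix (Fin rx) (Fin rz) ℝ × Matrix (Fin rz) (Fin rx) ℝ × (Fin rz → ℝ) =>
      reducedLoss γ B Wy w.1 (w.2.1 * B) w.2.2)
    {w | w.2.1 * A = 0 ∧ ∀ k, w.2.2 k ≠ 0} (V, Z, s)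

theorem IsReducedMinimum.eventually_le {γ : ℝ} {Wy : Matrix (Fin ry) (Fin rx) ℝ}
    {V : Matrix (Fin rx) (Fin rz) ℝ} {Z : Matrix (Fin rz) (Fin rx) ℝ} {s : Fin rz → ℝ}
    (h : IsReducedMinimum γ A B Wy V Z s) {V' : ℝ → Matrix (Fin rx) (Fin rz) ℝ}
    {Z' : ℝ → Matrix (Fin rz) (Fin rx) ℝ} {s' : ℝ → Fin rz → ℝ} (hV : ContinuousAt V' 0)
    (hZ : ContinuousAt Z' 0) (hs : ContinuousAt s' 0) (hV0 : V' 0 = V) (hZ0 : Z' 0 = Z)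
    (hs0 : s' 0 = s) (hA : ∀ t, Z' t * A = 0) :
    ∀ᶠ t in 𝓝[>] (0 : ℝ), reducedLoss γ B Wy V (Z * B) s ≤
      reducedLoss γ B Wy (V' t) (Z' t * B) (s' t) := by
  refine eventually_le_of_isLocalMinOn h.isLocalMinOn (g := fun t => (V' t, Z' t, s' t))
    (hV.prodMk (hZ.prodMk hs)) (by simp [hV0, hZ0, hs0]) ?_
  have : ∀ᶠ t in 𝓝 (0 : ℝ), ∀ k, s' t k ≠ 0 := eventually_all.2 fun k =>
    ((continuous_apply k).continuousAt.comp hs).eventually_ne (by simp [hs0, h.s_ne_zero k])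
  exact nhdsWithin_le_nhds (this.mono fun t ht => ⟨hA t, ht⟩)

theorem Params.covY_eq (γ : ℝ) (p : Params rx ry rz) :
    p.covY γ = γ • (1 : Matrix (Fin ry) (Fin ry) ℝ) + (p.Wy * p.Vx) * (p.Wy * p.Vx)ᵀ := by
  simp [Params.covY, Matrix.mul_assoc]

theorem continuous_params_iff {α : Type*} [TopologicalSpace α] {f : α → Params rx ry rz} :
    Continuous f ↔ Continuous fun a => (f a).toProd :=
  continuous_induced_rng

namespace IsAffineSurjectiveModel

variable {γ : ℝ} {p : Params rx ry rz}

/-- The quantities `A - W_x`, `c - b_x`, `W_z A` and `W_z c + b_z` enter the loss through a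
nonnegative quadratic form and can be rescaled independently of all else; at a local minimum they
vanish. -/
theorem eq_of_isMinimum (hmodel : IsAffineSurjectiveModel μ A B c D e Y U) (hγ : 0 < γ)
    (hp : p.IsMinimum (lawX μ A B c Y U) (μ.map Y) γ) :
    p.Wx = A ∧ p.bx = c ∧ p.Wz * A = 0 ∧ p.bz = -(p.Wz *ᵥ c) := by
  obtain ⟨hs, h1, h2, h3⟩ := (hmodel.mem_feasible_iff p).1 hp.1
  set q : ℝ → Params rx ry rz := fun t =>
    { Wx := p.Wx + t • (A - p.Wx), Vx := p.Vx, bx := p.bx + t • (c - p.bx), Wy := p.Wy, bY := p.bY,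
      Wz := p.Wz - t • (p.Wz * A * D),
      bz := p.bz - t • p.encMean c + t • ((p.Wz * A * D) *ᵥ c), s := p.s } with hq
  have hq0 : q 0 = p := by simp [hq]
  have hqc : Continuous q := by
    rw [continuous_params_iff]
    simp only [hq, Params.toProd]
    fun_prop
  have hqf : ∀ t, q t ∈ Params.feasible rz (lawX μ A B c Y U) (μ.map Y) := fun t =>
    (hmodel.mem_feasible_iff (q t)).2 ⟨hs, h1, h2, h3⟩
  have hev := eventually_le_of_isLocalMinOn hp.2 hqc.continuousAt hq0
    (Eventually.of_forall hqf)
  have e1 : ∀ t, A - (q t).Wx = (1 - t) • (A - p.Wx) := fun t => by simp only [hq]; module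
  have e2 : ∀ t, c - (q t).bx = (1 - t) • (c - p.bx) := fun t => by simp only [hq]; module
  have e3 : ∀ t, (q t).Wz * A = (1 - t) • (p.Wz * A) := fun t => by
    simp only [hq, Matrix.sub_mul, Matrix.smul_mul, Matrix.mul_assoc, hmodel.D_mul_A,
      Matrix.mul_one]
    module
  have e4 : ∀ t, (q t).Wz * B = p.Wz * B := fun t => by
    simp [hq, Matrix.sub_mul, Matrix.smul_mul, Matrix.mul_assoc, hmodel.D_mul_B]
  have e5 : ∀ t, (q t).encMean c = (1 - t) • p.encMean c := fun t => by
    simp only [Params.encMean, hq, sub_mulVec, smul_mulVec]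
    module
  have e6 : ∀ t, (q t).covY γ = p.covY γ := fun t => rfl
  set T := (p.Wy * (A - p.Wx))ᵀ * (p.covY γ)⁻¹ * (p.Wy * (A - p.Wx)) with hT
  set T' := (p.Wy *ᵥ (c - p.bx)) ⬝ᵥ ((p.covY γ)⁻¹ *ᵥ (p.Wy *ᵥ (c - p.bx))) with hT'
  set F := A - p.Wx - p.Vx * (p.Wz * A) with hF
  set d := c - p.bx - p.Vx *ᵥ p.encMean c with hd
  have hloss : ∀ t, Params.lossCycle (lawX μ A B c Y U) (μ.map Y) γ (q t) =
      Params.lossCycle (lawX μ A B c Y U) (μ.map Y) γ p + ((1 - t) ^ 2 - 1) *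
        ((1 / γ) * (frob F F + d ⬝ᵥ d) + frob (p.Wz * A) (p.Wz * A) +
          p.encMean c ⬝ᵥ p.encMean c + T.trace + T') := fun t => by
    have f1 : (1 - t) • (A - p.Wx) - p.Vx * ((1 - t) • (p.Wz * A)) = (1 - t) • F := by
      rw [Matrix.mul_smul, ← smul_sub]
    have f2 : (1 - t) • (c - p.bx) - p.Vx *ᵥ ((1 - t) • p.encMean c) = (1 - t) • d := by
      rw [mulVec_smul, ← smul_sub]
    have f3 : (q t).Vx = p.Vx ∧ (q t).s = p.s ∧ (q t).Wy = p.Wy := ⟨rfl, rfl, rfl⟩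
    unfold Params.lossCycle
    rw [hmodel.lossX_eq γ (p := q t) h1 h2 h3, hmodel.lossY_eq γ (p := q t) h1 h3,
      hmodel.lossX_eq γ h1 h2 h3, hmodel.lossY_eq γ h1 h3, e1, e2, e3, e4, e5, e6, f3.1, f3.2.1,
      f3.2.2, f1, f2, ← hF, ← hd, ← hT, ← hT']
    simp only [Matrix.mul_smul, mulVec_smul, transpose_smul, Matrix.smul_mul, trace_smul,
      frob_smul_left, frob_smul_right, smul_dotProduct, dotProduct_smul, smul_eq_mul, ← hT,
      ← hT']
    ring
  have hK : (1 / γ) * (frob F F + d ⬝ᵥ d) + frob (p.Wz * A) (p.Wz * A) +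
          p.encMean c ⬝ᵥ p.encMean c + T.trace + T' ≤ 0 := by
    obtain ⟨t, ht, ht1⟩ := (hev.and (Ioo_mem_nhdsGT (show (0 : ℝ) < 1 by norm_num))).exists
    rw [hloss] at ht
    have : (1 - t) ^ 2 - 1 < 0 := by nlinarith [ht1.1, ht1.2]
    nlinarith
  have hpd : (p.covY γ)⁻¹.PosSemidef := by
    rw [Params.covY_eq]
    exact (posDef_smul_one_add hγ _).inv.posSemidef
  have hTn : 0 ≤ T.trace := by
    have := hpd.conjTranspose_mul_mul_same (p.Wy * (A - p.Wx))
    rw [conjTranspose_eq_transpose_of_trivial] at this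
    exact this.trace_nonneg
  have hTn' : 0 ≤ T' := by
    have := hpd.dotProduct_mulVec_nonneg (p.Wy *ᵥ (c - p.bx))
    rwa [star_trivial] at this
  have hFn := frob_self_nonneg F
  have hAn := frob_self_nonneg (p.Wz * A)
  have hsq : ∀ {n : ℕ} (x : Fin n → ℝ), 0 ≤ x ⬝ᵥ x := fun x =>
    Finset.sum_nonneg fun _ _ => mul_self_nonneg _
  have hdn := hsq d
  have hmn := hsq (p.encMean c)
  have hgi : 0 < 1 / γ := by positivity
  have hgn : 0 ≤ 1 / γ * (frob F F + d ⬝ᵥ d) := by positivity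
  have hM : p.Wz * A = 0 := frob_self_eq_zero.1 (by linarith)
  have hm : p.encMean c = 0 := dotProduct_self_eq_zero.1 (by linarith)
  have hg0 : frob F F + d ⬝ᵥ d = 0 := by
    have : 1 / γ * (frob F F + d ⬝ᵥ d) = 0 := by linarith
    simpa [hγ.ne'] using this
  have hF0 : F = 0 := frob_self_eq_zero.1 (by linarith)
  have hd0 : d = 0 := dotProduct_self_eq_zero.1 (by linarith)
  rw [hF, hM, Matrix.mul_zero, sub_zero, sub_eq_zero] at hF0
  rw [hd, hm, mulVec_zero, sub_zero, sub_eq_zero] at hd0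
  exact ⟨hF0.symm, hd0.symm, hM, by
    rw [eq_neg_iff_add_eq_zero, add_comm]; exact hm⟩

theorem isReducedMinimum (hmodel : IsAffineSurjectiveModel μ A B c D e Y U) (hγ : 0 < γ)
    (hp : p.IsMinimum (lawX μ A B c Y U) (μ.map Y) γ) :
    IsReducedMinimum γ A B p.Wy p.Vx p.Wz p.s := by
  obtain ⟨hs, h1, h2, h3⟩ := (hmodel.mem_feasible_iff p).1 hp.1
  obtain ⟨hWx, hbx, hWz, hbz⟩ := hmodel.eq_of_isMinimum hγ hp
  refine ⟨hWz, hs, ?_⟩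
  set q : Matrix (Fin rx) (Fin rz) ℝ × Matrix (Fin rz) (Fin rx) ℝ × (Fin rz → ℝ) →
      Params rx ry rz := fun w =>
    { Wx := A, Vx := w.1, bx := c, Wy := p.Wy, bY := p.bY, Wz := w.2.1, bz := -(w.2.1 *ᵥ c),
      s := w.2.2 } with hq
  have hq0 : q (p.Vx, p.Wz, p.s) = p := by
    simp only [hq]
    rw [← hWx, ← hbz]
    cases p
    simp_all
  have hqc : Continuous q := by
    rw [continuous_params_iff]
    simp only [hq, Params.toProd]
    fun_prop
  have hloss : ∀ w : Matrix (Fin rx) (Fin rz) ℝ × Matrix (Fin rz) (Fin rx) ℝ × (Fin rz → ℝ),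
      w.2.1 * A = 0 → Params.lossCycle (lawX μ A B c Y U) (μ.map Y) γ (q w) =
      rx * Real.log γ + reducedLoss γ B p.Wy w.1 (w.2.1 * B) w.2.2 := fun w hw => by
    have hm : (q w).encMean c = 0 := by simp [Params.encMean, hq]
    have hw' : (q w).Wz * A = 0 := hw
    unfold Params.lossCycle reducedLoss
    rw [hmodel.lossX_eq γ (p := q w) h1 h2 h3, hmodel.lossY_eq γ (p := q w) h1 h3, hm, hw',
      Params.covY_eq]
    simp [hq, frob]
    ring
  have hmin : ∀ᶠ p' in 𝓝[Params.feasible rz (lawX μ A B c Y U) (μ.map Y)] p,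
      Params.lossCycle (lawX μ A B c Y U) (μ.map Y) γ p ≤
        Params.lossCycle (lawX μ A B c Y U) (μ.map Y) γ p' := hp.2
  have htend : Tendsto q (𝓝[{w | w.2.1 * A = 0 ∧ ∀ k, w.2.2 k ≠ 0}] (p.Vx, p.Wz, p.s))
      (𝓝[Params.feasible rz (lawX μ A B c Y U) (μ.map Y)] p) := by
    refine tendsto_nhdsWithin_iff.2 ⟨?_, ?_⟩
    · have := hqc.tendsto (p.Vx, p.Wz, p.s)
      rw [hq0] at this
      exact this.mono_left nhdsWithin_le_nhds
    · exact eventually_mem_nhdsWithin.mono fun w hw =>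
        (hmodel.mem_feasible_iff (q w)).2 ⟨hw.2, h1, h2, h3⟩
  have := (htend.eventually hmin).and eventually_mem_nhdsWithin
  refine this.mono fun w hw => ?_
  have h := hw.1
  rw [hloss w hw.2.1, ← hq0, hloss _ hWz] at h
  exact (add_le_add_iff_left _).1 h

end IsAffineSurjectiveModel

end CycleCVAE

namespace CycleCVAE

variable {rx ry ru rz : ℕ} {A : Matrix (Fin rx) (Fin ry) ℝ} {B : Matrix (Fin rx) (Fin ru) ℝ}
  {D : Matrix (Fin ry) (Fin rx) ℝ} {X₀ : Matrix (Fin ru) (Fin rx) ℝ}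

/-! ### First- and second-order conditions at a reduced minimum -/

/-- The trivial bound `log x ≥ 1 - 1/x` turns the minimality of `x ↦ β x² - 2 log x` at `x = 1`
into `β = 1`. -/
theorem eq_one_of_eventually_log_le {β : ℝ}
    (h : ∀ ε : ℝ, ε = 1 ∨ ε = -1 →
      ∀ᶠ t in 𝓝[>] (0 : ℝ), β ≤ β * (1 + ε * t) ^ 2 - 2 * Real.log (1 + ε * t)) : β = 1 := by
  have key : ∀ ε : ℝ, ε = 1 ∨ ε = -1 → 0 ≤ ε * (β - 1) := fun ε hε => by
    have hεε : ε * ε = 1 := by rcases hε with rfl | rfl <;> norm_num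
    have hlim : Tendsto (fun t : ℝ => β * (2 * ε + t) - 2 * ε / (1 + ε * t)) (𝓝[>] 0)
        (𝓝 (β * (2 * ε + 0) - 2 * ε / (1 + ε * 0))) := by
      refine Tendsto.mono_left ?_ nhdsWithin_le_nhds
      refine ContinuousAt.tendsto (f := fun t : ℝ => β * (2 * ε + t) - 2 * ε / (1 + ε * t)) ?_
      exact ContinuousAt.sub (by fun_prop)
        (ContinuousAt.div (by fun_prop) (by fun_prop) (by norm_num))
    have := ge_of_tendsto hlim (b := 0) (by
      filter_upwards [h ε hε, Ioo_mem_nhdsGT (show (0 : ℝ) < 1 / 2 by norm_num)] with t ht ht1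
      have hpos : 0 < 1 + ε * t := by
        rcases hε with rfl | rfl <;> linarith [ht1.1, ht1.2]
      have hlog := Real.one_sub_inv_le_log_of_pos hpos
      have e1 : 1 - (1 + ε * t)⁻¹ = t * (ε / (1 + ε * t)) := by field_simp; ring
      rw [e1] at hlog
      have h2 : 0 ≤ t * (β * (2 * ε + t) - 2 * ε / (1 + ε * t)) := by
        have e2 : t * (β * (2 * ε + t) - 2 * ε / (1 + ε * t)) =
          β * (2 * ε * t + (ε * ε) * t ^ 2) - 2 * (t * (ε / (1 + ε * t))) := by rw [hεε]; ring
        rw [e2]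
        nlinarith
      exact nonneg_of_mul_nonneg_right h2 ht1.1)
    norm_num at this
    linarith
  have h1 := key 1 (Or.inl rfl)
  have h2 := key (-1) (Or.inr rfl)
  linarith

namespace IsReducedMinimum

variable {γ : ℝ} {Wy : Matrix (Fin ry) (Fin rx) ℝ} {V : Matrix (Fin rx) (Fin rz) ℝ}
  {Z : Matrix (Fin rz) (Fin rx) ℝ} {s : Fin rz → ℝ}

/-- Shrinking the component of `V` orthogonal to the column space of `B` decreases every term of the
loss, hence that component is zero. -/
theorem mul_normal_equation (h : IsReducedMinimum γ A B Wy V Z s) (hγ : 0 < γ)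
    (hWB : Wy * B = 0) (hX : Bᵀ * B * X₀ = Bᵀ) : B * X₀ * V = V := by
  set P := B * X₀ * V with hP
  set Q := V - P with hQ
  set N := Z * B
  have hBQ : Bᵀ * Q = 0 := by
    rw [hQ, hP, Matrix.mul_sub, ← Matrix.mul_assoc, ← Matrix.mul_assoc, hX, sub_self]
  have hPQ : Pᵀ * Q = 0 := by
    rw [hP, Matrix.mul_assoc, transpose_mul, Matrix.mul_assoc, hBQ, Matrix.mul_zero]
  have hQP : Qᵀ * P = 0 := by
    have := congrArg transpose hPQ
    simpa using this
  have hWP : Wy * P = 0 := by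
    rw [hP, Matrix.mul_assoc, ← Matrix.mul_assoc, hWB, Matrix.zero_mul]
  have hVPQ : V = P + Q := by rw [hQ]; abel
  have hev := h.eventually_le (V' := fun t => V - t • Q) (Z' := fun _ => Z) (s' := fun _ => s)
    (by fun_prop) continuousAt_const continuousAt_const (by simp) rfl rfl (fun _ => h.Z_mul_A)
  have f1 : ∀ t : ℝ, V - t • Q = P + (1 - t) • Q := fun t => by
    conv_lhs => rw [hVPQ]
    module
  have f2 : ∀ a : ℝ, frob (B - (P + a • Q) * N) (B - (P + a • Q) * N) =
      frob (B - P * N) (B - P * N) + a ^ 2 * frob (Q * N) (Q * N) := fun a => by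
    have e1 : B - (P + a • Q) * N = (B - P * N) + (-a) • (Q * N) := by
      rw [Matrix.add_mul, Matrix.smul_mul]; module
    have e2 : frob (B - P * N) (Q * N) = 0 := by
      have : B - P * N = B * (1 - X₀ * V * N) := by
        rw [hP, Matrix.mul_sub, Matrix.mul_one]; simp only [Matrix.mul_assoc]
      have hBQN : Bᵀ * (Q * N) = 0 := by rw [← Matrix.mul_assoc, hBQ, Matrix.zero_mul]
      rw [this, frob_mul_left, hBQN]
      simp [frob]
    rw [e1, frob_add_smul_self, e2]
    ring
  have f3 : ∀ (a : ℝ) k, ((P + a • Q)ᵀ * (P + a • Q)) k k =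
      (Pᵀ * P) k k + a ^ 2 * (Qᵀ * Q) k k := fun a k => by
    simp only [transpose_add, transpose_smul, Matrix.add_mul, Matrix.mul_add, Matrix.smul_mul,
      Matrix.mul_smul, hPQ, hQP]
    simp
    ring
  have f4 : ∀ a : ℝ, Wy * (P + a • Q) = a • (Wy * V) := fun a => by
    rw [hVPQ, Matrix.mul_add, Matrix.mul_add, hWP, Matrix.mul_smul, zero_add, zero_add]
  have f5 : ∀ a : ℝ, ∑ k, s k ^ 2 * ((P + a • Q)ᵀ * (P + a • Q)) k k =
      ∑ k, s k ^ 2 * (Pᵀ * P) k k + a ^ 2 * ∑ k, s k ^ 2 * (Qᵀ * Q) k k := fun a => by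
    simp_rw [f3, mul_add, Finset.sum_add_distrib, Finset.mul_sum]
    congr 1
    exact Finset.sum_congr rfl fun k _ => by ring
  obtain ⟨t, ht, ht1⟩ := (hev.and (Ioo_mem_nhdsGT (show (0 : ℝ) < 1 by norm_num))).exists
  have hdet := log_det_smul_le (a := 1 - t) hγ (by nlinarith [ht1.1, ht1.2]) (Wy * V)
  have hV1 : V = P + (1 : ℝ) • Q := by rw [one_smul]; exact hVPQ
  unfold reducedLoss at ht
  rw [f1, f2, f5, f4] at ht
  have g2 := f2 1
  have g5 := f5 1
  rw [← hV1] at g2 g5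
  rw [g2, g5] at ht
  have hQN := frob_self_nonneg (Q * N)
  have hterm : ∀ k ∈ Finset.univ, 0 ≤ s k ^ 2 * (Qᵀ * Q) k k := fun k _ =>
    mul_nonneg (sq_nonneg _) (transpose_mul_self_apply_nonneg _ _)
  have hsn := Finset.sum_nonneg hterm
  have hle : (1 / γ) * (1 - (1 - t) ^ 2) *
      (frob (Q * N) (Q * N) + ∑ k, s k ^ 2 * (Qᵀ * Q) k k) ≤ 0 := by
    linarith
  have hfac : 0 < (1 / γ) * (1 - (1 - t) ^ 2) :=
    mul_pos (by positivity) (by nlinarith [ht1.1, ht1.2])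
  have hle' := nonpos_of_mul_nonpos_right hle hfac
  have h0 : ∑ k, s k ^ 2 * (Qᵀ * Q) k k = 0 := by linarith
  rw [Finset.sum_eq_zero_iff_of_nonneg hterm] at h0
  have hQ0 : Q = 0 := frob_self_eq_zero.1 <| Finset.sum_eq_zero fun k hk => by
    simpa [h.s_ne_zero k] using h0 k hk
  exact (sub_eq_zero.1 hQ0).symm

/-- Along paths on which `W_y V` vanishes the log-determinant is constant, so that the remaining
terms satisfy the minimality inequality by themselves. -/
theorem eventually_le_of_mul_eq_zero (h : IsReducedMinimum γ A B Wy V Z s)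
    {V' : ℝ → Matrix (Fin rx) (Fin rz) ℝ} {Z' : ℝ → Matrix (Fin rz) (Fin rx) ℝ}
    {s' : ℝ → Fin rz → ℝ} (hV : ContinuousAt V' 0) (hZ : ContinuousAt Z' 0)
    (hs : ContinuousAt s' 0) (hV0 : V' 0 = V) (hZ0 : Z' 0 = Z) (hs0 : s' 0 = s)
    (hA : ∀ t, Z' t * A = 0) (hW : ∀ t, Wy * V' t = 0) :
    ∀ᶠ t in 𝓝[>] (0 : ℝ),
      (1 / γ) * (frob (B - V * (Z * B)) (B - V * (Z * B)) + ∑ k, s k ^ 2 * (Vᵀ * V) k k) +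
        ∑ k, (s k ^ 2 - Real.log (s k ^ 2)) + frob (Z * B) (Z * B) ≤
      (1 / γ) * (frob (B - V' t * (Z' t * B)) (B - V' t * (Z' t * B)) +
        ∑ k, s' t k ^ 2 * ((V' t)ᵀ * V' t) k k) +
        ∑ k, (s' t k ^ 2 - Real.log (s' t k ^ 2)) + frob (Z' t * B) (Z' t * B) := by
  filter_upwards [h.eventually_le hV hZ hs hV0 hZ0 hs0 hA] with t ht
  have hWV : Wy * V = 0 := hV0 ▸ hW 0
  unfold reducedLoss at ht
  rw [hW, hWV] at ht
  linarith

theorem sq_mul_eq (h : IsReducedMinimum γ A B Wy V Z s) (hγ : 0 < γ) (hWV : Wy * V = 0)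
    (k : Fin rz) : s k ^ 2 * (γ + (Vᵀ * V) k k) = γ := by
  suffices hβ : s k ^ 2 * (1 + (Vᵀ * V) k k / γ) = 1 by
    field_simp at hβ
    linarith
  refine eq_one_of_eventually_log_le fun ε hε => ?_
  have hs' : Continuous fun t : ℝ => Function.update s k (s k * (1 + ε * t)) := by fun_prop
  have hev := h.eventually_le_of_mul_eq_zero (V' := fun _ => V) (Z' := fun _ => Z)
    continuousAt_const continuousAt_const hs'.continuousAt rfl rfl (by simp)
    (fun _ => h.Z_mul_A) (fun _ => hWV)
  filter_upwards [hev, Ioo_mem_nhdsGT (show (0 : ℝ) < 1 / 2 by norm_num)] with t ht ht1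
  have hpos : 0 < 1 + ε * t := by rcases hε with rfl | rfl <;> linarith [ht1.1, ht1.2]
  have e1 : ∑ l, (Function.update s k (s k * (1 + ε * t))) l ^ 2 * (Vᵀ * V) l l =
      ∑ l, s l ^ 2 * (Vᵀ * V) l l + (s k ^ 2 * ((1 + ε * t) ^ 2 - 1)) * (Vᵀ * V) k k := by
    rw [← Finset.add_sum_erase _ _ (Finset.mem_univ k),
      ← Finset.add_sum_erase (f := fun l => s l ^ 2 * (Vᵀ * V) l l) _ (Finset.mem_univ k),
      Finset.sum_congr rfl fun l hl => by
        rw [Function.update_of_ne (Finset.ne_of_mem_erase hl)]]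
    simp
    ring
  have e2 : ∑ l, ((Function.update s k (s k * (1 + ε * t))) l ^ 2 -
        Real.log ((Function.update s k (s k * (1 + ε * t))) l ^ 2)) =
      ∑ l, (s l ^ 2 - Real.log (s l ^ 2)) + s k ^ 2 * ((1 + ε * t) ^ 2 - 1) -
        2 * Real.log (1 + ε * t) := by
    rw [← Finset.add_sum_erase _ _ (Finset.mem_univ k),
      ← Finset.add_sum_erase (f := fun l => s l ^ 2 - Real.log (s l ^ 2)) _ (Finset.mem_univ k),
      Finset.sum_congr rfl fun l hl => by
        rw [Function.update_of_ne (Finset.ne_of_mem_erase hl)]]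
    simp only [Function.update_self]
    rw [mul_pow, Real.log_mul (pow_ne_zero _ (h.s_ne_zero k)) (pow_ne_zero _ hpos.ne'),
      Real.log_pow (1 + ε * t)]
    push_cast
    ring
  rw [e1, e2] at ht
  have e3 : s k ^ 2 * (1 + (Vᵀ * V) k k / γ) * (1 + ε * t) ^ 2 =
      s k ^ 2 * (1 + (Vᵀ * V) k k / γ) + (1 / γ) * ((s k ^ 2 * ((1 + ε * t) ^ 2 - 1)) *
        (Vᵀ * V) k k) + s k ^ 2 * ((1 + ε * t) ^ 2 - 1) := by ring
  rw [e3]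
  linarith

/-- Stationarity in the encoder weight. -/
theorem smul_encoder_eq (h : IsReducedMinimum γ A B Wy V Z s) (hγ : 0 < γ) (hWV : Wy * V = 0)
    (hDA : D * A = 1) (hDB : D * B = 0) : γ • (Z * B) = Vᵀ * (B - V * (Z * B)) := by
  set N := Z * B with hN
  set E := γ • N - Vᵀ * (B - V * N) with hE
  set H := (γ • Z - Vᵀ * (1 - V * Z)) * (1 - A * D) with hH
  have hHA : H * A = 0 := by
    rw [hH, Matrix.mul_assoc, Matrix.sub_mul 1, Matrix.mul_assoc A, hDA]
    simp
  have hHB : H * B = E := by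
    rw [hH, Matrix.mul_assoc, Matrix.sub_mul 1, Matrix.mul_assoc A, hDB, hE, hN]
    simp [Matrix.sub_mul, Matrix.mul_assoc]
  have hev := h.eventually_le_of_mul_eq_zero (V' := fun _ => V) (Z' := fun t => Z + (-t) • H)
    (s' := fun _ => s) continuousAt_const (by fun_prop) continuousAt_const rfl (by simp) rfl
    (fun t => by simp [Matrix.add_mul, h.Z_mul_A, hHA]) (fun _ => hWV)
  have hE0 : (2 / γ) * frob E E ≤ 0 := by
    refine nonpos_of_eventually_le_pow_mul one_ne_zero
      (b := (1 / γ) * frob (V * E) (V * E) + frob E E) ?_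
    filter_upwards [hev, self_mem_nhdsWithin] with t ht ht0
    have e1 : (Z + (-t) • H) * B = N + (-t) • E := by
      rw [Matrix.add_mul, Matrix.smul_mul, hHB]
    have e2 : B - V * (N + (-t) • E) = (B - V * N) + t • (V * E) := by
      rw [Matrix.mul_add, Matrix.mul_smul]; module
    have e3 : frob (B - V * N) (V * E) = γ * frob N E - frob E E := by
      have : Vᵀ * (B - V * N) = γ • N - E := by rw [hE]; abel
      rw [frob_comm, frob_mul_left, this, frob_sub_right, frob_smul_right, frob_comm E N]
    rw [e1, e2, frob_add_smul_self, frob_add_smul_self, e3] at ht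
    have e4 : (1 / γ) * (2 * t * (γ * frob N E - frob E E)) =
        2 * t * frob N E - t * ((2 / γ) * frob E E) := by field_simp
    have : t * ((2 / γ) * frob E E) ≤
        t * (t ^ 1 * ((1 / γ) * frob (V * E) (V * E) + frob E E)) := by
      linarith
    exact le_of_mul_le_mul_left this ht0
  have hEE : frob E E = 0 :=
    le_antisymm (nonpos_of_mul_nonpos_right hE0 (by positivity)) (frob_self_nonneg E)
  exact sub_eq_zero.1 (frob_self_eq_zero.1 hEE)

/-- Stationarity in the decoder weight. -/
theorem residual_mul_transpose (h : IsReducedMinimum γ A B Wy V Z s) (hγ : 0 < γ)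
    (hWB : Wy * B = 0) (hWV : Wy * V = 0) :
    (B - V * (Z * B)) * (Z * B)ᵀ = V * Matrix.diagonal fun k => s k ^ 2 := by
  set N := Z * B with hN
  set S := Matrix.diagonal fun k => s k ^ 2 with hS
  set E := (B - V * N) * Nᵀ - V * S with hE
  have hWE : Wy * E = 0 := by
    have hWVN : Wy * (V * N) = 0 := by rw [← Matrix.mul_assoc, hWV, Matrix.zero_mul]
    have hWVS : Wy * (V * S) = 0 := by rw [← Matrix.mul_assoc, hWV, Matrix.zero_mul]
    rw [hE, Matrix.mul_sub, hWVS, ← Matrix.mul_assoc Wy (B - V * N), Matrix.mul_sub Wy B, hWB, hWVN]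
    simp
  have hev := h.eventually_le_of_mul_eq_zero (V' := fun t => V + t • E) (Z' := fun _ => Z)
    (s' := fun _ => s) (by fun_prop) continuousAt_const continuousAt_const (by simp) rfl rfl
    (fun t => h.Z_mul_A) (fun t => by rw [Matrix.mul_add, Matrix.mul_smul, hWE, hWV]; simp)
  have hE0 : (2 / γ) * frob E E ≤ 0 := by
    refine nonpos_of_eventually_le_pow_mul one_ne_zero
      (b := (1 / γ) * (frob (E * N) (E * N) + frob (E * S) E)) ?_
    filter_upwards [hev, self_mem_nhdsWithin] with t ht ht0
    have e2 : B - (V + t • E) * N = (B - V * N) + (-t) • (E * N) := by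
      rw [Matrix.add_mul, Matrix.smul_mul]; module
    have e3 : frob (B - V * N) (E * N) = frob E E + frob (V * S) E := by
      have : (B - V * N) * Nᵀ = E + V * S := by rw [hE]; abel
      rw [frob_comm, frob_mul_right, this, frob_add_right, frob_comm E (V * S)]
    have e4 : frob ((V + t • E) * S) (V + t • E) =
        frob (V * S) V + 2 * t * frob (V * S) E + t ^ 2 * frob (E * S) E := by
      have : frob (E * S) V = frob (V * S) E := by
        rw [frob_mul_right, frob_comm, hS, diagonal_transpose]
      rw [Matrix.add_mul, Matrix.smul_mul]
      simp only [frob_add_left, frob_add_right, frob_smul_left, frob_smul_right, this]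
      ring
    simp only [sum_mul_transpose_mul_self, ← hS, ← hN] at ht
    rw [e2, frob_add_smul_self, e3, e4] at ht
    have : t * ((2 / γ) * frob E E) ≤
        t * (t ^ 1 * ((1 / γ) * (frob (E * N) (E * N) + frob (E * S) E))) := by
      have e5 : t * ((2 / γ) * frob E E) = (1 / γ) * (2 * t * frob E E) := by ring
      rw [e5]
      linarith
    exact le_of_mul_le_mul_left this ht0
  have hEE : frob E E = 0 :=
    le_antisymm (nonpos_of_mul_nonpos_right hE0 (by positivity)) (frob_self_nonneg E)
  exact sub_eq_zero.1 (frob_self_eq_zero.1 hEE)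

/-- The columns of the decoder weight are orthogonal. A rotation in latent space only changes
`∑ log (γ + |v_k|²)`, the value of the `s`-terms at the optimal `s`, and a planar rotation that
mixes two non-orthogonal columns decreases that sum. -/
theorem transpose_mul_self_apply_of_ne (h : IsReducedMinimum γ A B Wy V Z s) (hγ : 0 < γ)
    (hWV : Wy * V = 0) {i j : Fin rz} (hij : i ≠ j) : (Vᵀ * V) i j = 0 := by
  by_contra hg
  have hγn : ∀ (W : Matrix (Fin rx) (Fin rz) ℝ) k, 0 < γ + (Wᵀ * W) k k := fun W k =>
    add_pos_of_pos_of_nonneg hγ (transpose_mul_self_apply_nonneg W k)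
  obtain ⟨ε, -, hdec⟩ := exists_rotation_mul_lt (γ + (Vᵀ * V) i i) (γ + (Vᵀ * V) j j) hg
  set R : ℝ → Matrix (Fin rz) (Fin rz) ℝ := fun t => planeRotation i j (ε * t) with hR
  have hRc : Continuous R := (continuous_planeRotation i j).comp (by fun_prop)
  have hR0 : R 0 = 1 := by simp [hR, planeRotation_zero]
  have hRR : ∀ t, R t * (R t)ᵀ = 1 := fun t => planeRotation_mul_transpose hij _
  set n : ℝ → Fin rz → ℝ := fun t k => γ + ((V * R t)ᵀ * (V * R t)) k k with hn
  have hnpos : ∀ t k, 0 < n t k := fun t k => hγn _ k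
  have hn0 : ∀ k, n 0 k = γ + (Vᵀ * V) k k := fun k => by simp [hn, hR0]
  have hnc : ∀ k, Continuous fun t => n t k := fun k => by
    have : Continuous fun t => (V * R t)ᵀ * (V * R t) := by fun_prop
    exact continuous_const.add (this.matrix_elem k k)
  set s' : ℝ → Fin rz → ℝ := fun t k => s k * √(n 0 k / n t k) with hs'
  have hs'c : Continuous s' := continuous_pi fun k => continuous_const.mul
    (continuous_const.div (hnc k) fun t => (hnpos t k).ne').sqrt
  have hs'sq : ∀ t k, s' t k ^ 2 = γ / n t k := fun t k => by
    have h1 := h.sq_mul_eq hγ hWV k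
    rw [← hn0] at h1
    rw [hs', mul_pow, Real.sq_sqrt (div_pos (hnpos 0 k) (hnpos t k)).le, ← h1, mul_div_assoc]
  have hs'0 : s' 0 = s := by
    funext k
    simp [hs', (hnpos 0 k).ne']
  have hev := h.eventually_le_of_mul_eq_zero (V' := fun t => V * R t)
    (Z' := fun t => (R t)ᵀ * Z) (s' := s') (by fun_prop) (by fun_prop) hs'c.continuousAt
    (by simp [hR0]) (by simp [hR0]) hs'0
    (fun t => by rw [Matrix.mul_assoc, h.Z_mul_A, Matrix.mul_zero])
    (fun t => by rw [← Matrix.mul_assoc, hWV, Matrix.zero_mul])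
  have hsum : ∀ t, (1 / γ) * ∑ k, s' t k ^ 2 * ((V * R t)ᵀ * (V * R t)) k k +
      ∑ k, (s' t k ^ 2 - Real.log (s' t k ^ 2)) =
      ∑ k, (1 - Real.log γ) + ∑ k, Real.log (n t k) := fun t => by
    rw [Finset.mul_sum, ← Finset.sum_add_distrib, ← Finset.sum_add_distrib]
    refine Finset.sum_congr rfl fun k _ => ?_
    have e1 : ((V * R t)ᵀ * (V * R t)) k k = n t k - γ := by simp [hn]
    have e2 := (hnpos t k).ne'
    rw [hs'sq, e1, Real.log_div hγ.ne' e2]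
    field_simp
    ring
  obtain ⟨t, ht, hlt⟩ := (hev.and hdec).exists
  have e1 : V * R t * ((R t)ᵀ * Z * B) = V * (Z * B) := by
    rw [Matrix.mul_assoc (R t)ᵀ, Matrix.mul_assoc V, ← Matrix.mul_assoc (R t), hRR, Matrix.one_mul]
  have e2 : frob ((R t)ᵀ * Z * B) ((R t)ᵀ * Z * B) = frob (Z * B) (Z * B) := by
    rw [Matrix.mul_assoc, frob_mul_left, transpose_transpose, ← Matrix.mul_assoc, hRR,
      Matrix.one_mul]
  have e3 := hsum 0
  rw [hs'0, hR0, Matrix.mul_one] at e3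
  rw [e1, e2] at ht
  have hle : ∑ k, Real.log (n 0 k) ≤ ∑ k, Real.log (n t k) := by linarith [hsum t]
  have hdiff : ∑ k, (Real.log (n t k) - Real.log (n 0 k)) =
      (Real.log (n t i) - Real.log (n 0 i)) + (Real.log (n t j) - Real.log (n 0 j)) := by
    refine Fintype.sum_eq_add i j hij fun k hk => ?_
    have : n t k = n 0 k := by
      have h1 : ∀ W : Matrix (Fin rx) (Fin rz) ℝ, (Wᵀ * W) k k = W.col k ⬝ᵥ W.col k :=
        fun _ => rfl
      simp only [hn, h1, hR, col_mul_planeRotation_of_ne hk.1 hk.2]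
    rw [this, sub_self]
  rw [Finset.sum_sub_distrib] at hdiff
  have hcol : ∀ W : Matrix (Fin rx) (Fin rz) ℝ, ∀ k l, (Wᵀ * W) k l = W.col k ⬝ᵥ W.col l :=
    fun _ _ _ => rfl
  have hC := Real.cos_sq_add_sin_sq (ε * t)
  have hi : n t i = Real.cos (ε * t) ^ 2 * (γ + (Vᵀ * V) i i) +
      Real.sin (ε * t) ^ 2 * (γ + (Vᵀ * V) j j) +
      2 * Real.cos (ε * t) * Real.sin (ε * t) * (Vᵀ * V) i j := by
    simp only [hn, hcol, hR, col_mul_planeRotation_left hij, add_dotProduct, dotProduct_add,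
      smul_dotProduct, dotProduct_smul, smul_eq_mul, dotProduct_comm (V.col j) (V.col i)]
    linear_combination (-γ) * hC
  have hj : n t j = Real.sin (ε * t) ^ 2 * (γ + (Vᵀ * V) i i) +
      Real.cos (ε * t) ^ 2 * (γ + (Vᵀ * V) j j) -
      2 * Real.cos (ε * t) * Real.sin (ε * t) * (Vᵀ * V) i j := by
    simp only [hn, hcol, hR, col_mul_planeRotation_right hij, sub_dotProduct, dotProduct_sub,
      smul_dotProduct, dotProduct_smul, smul_eq_mul, dotProduct_comm (V.col j) (V.col i)]
    linear_combination (-γ) * hC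
  rw [← hi, ← hj, ← hn0, ← hn0] at hlt
  have hlog := Real.log_lt_log (mul_pos (hnpos t i) (hnpos t j)) hlt
  rw [Real.log_mul (hnpos t i).ne' (hnpos t j).ne', Real.log_mul (hnpos 0 i).ne' (hnpos 0 j).ne']
    at hlog
  linarith

end IsReducedMinimum

end CycleCVAE

namespace CycleCVAE

variable {rx ry ru rz : ℕ} {A : Matrix (Fin rx) (Fin ry) ℝ} {B : Matrix (Fin rx) (Fin ru) ℝ}
  {D : Matrix (Fin ry) (Fin rx) ℝ} {X₀ : Matrix (Fin ru) (Fin rx) ℝ}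

/-! ### The column space of the decoder weight -/

theorem transpose_mul_self_eq_diagonal {m n : Type*} [Fintype m] [DecidableEq n]
    {V : Matrix m n ℝ} (hV : ∀ i j, i ≠ j → (Vᵀ * V) i j = 0) :
    Vᵀ * V = Matrix.diagonal fun k => (Vᵀ * V) k k := by
  ext i j
  by_cases hij : i = j
  · subst hij; simp
  · rw [hV i j hij, Matrix.diagonal_apply_ne _ hij]

/-- For a matrix with orthogonal columns, `V G Vᵀ` with `G = diag (1 / |v_k|²)` (and `0` for a zero
column) is the orthogonal projection onto the column space; here in the form that the complementary
projection is annihilated by `Vᵀ`. -/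
theorem transpose_mul_orthogonal_projection {m n : Type*} [Fintype m] [Fintype n] [DecidableEq n]
    {V : Matrix m n ℝ} (hV : ∀ i j, i ≠ j → (Vᵀ * V) i j = 0) :
    Vᵀ * V * Matrix.diagonal (fun k => ((Vᵀ * V) k k)⁻¹) * Vᵀ = Vᵀ := by
  ext k a
  rw [transpose_mul_self_eq_diagonal hV, Matrix.diagonal_mul_diagonal, Matrix.diagonal_mul]
  simp only [Matrix.diagonal_apply_eq]
  by_cases h0 : (Vᵀ * V) k k = 0
  · have := congrFun (transpose_mul_self_apply_eq_zero.1 h0) a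
    simp only [col_apply] at this
    simp [this]
  · rw [mul_inv_cancel₀ h0, one_mul]

theorem vecMulVec_zero_right {m n : Type*} (w : m → ℝ) : vecMulVec w (0 : n → ℝ) = 0 :=
  ext fun _ _ => mul_zero _

theorem vecMulVec_mul_vecMulVec_eq {l m n : Type*} [Fintype m] (a : l → ℝ) (b c : m → ℝ)
    (d : n → ℝ) : vecMulVec a b * vecMulVec c d = (b ⬝ᵥ c) • vecMulVec a d := by
  rw [vecMulVec_mul, vecMul_vecMulVec, vecMulVec_smul]

namespace IsReducedMinimum

variable {γ δ : ℝ} {Wy : Matrix (Fin ry) (Fin rx) ℝ} {V : Matrix (Fin rx) (Fin rz) ℝ}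
  {Z : Matrix (Fin rz) (Fin rx) ℝ} {s : Fin rz → ℝ}

/-- For small `γ` an unused latent dimension is profitable as long as a direction of the column
space of `B` is not reconstructed: if the column `v_j` vanishes and `w` in the column space of `B`
is orthogonal to all columns, move to `v_j = t w`, `N_j = (t / γ) wᵀ B`. -/
theorem eq_zero_of_vecMul_eq_zero (h : IsReducedMinimum γ A B Wy V Z s) (hγ : 0 < γ)
    (hWB : Wy * B = 0) (hWV : Wy * V = 0) (hDA : D * A = 1) (hDB : D * B = 0) (hγδ : γ < δ)
    (hδ : ∀ u, δ * ((B *ᵥ u) ⬝ᵥ (B *ᵥ u)) ≤ (Bᵀ *ᵥ (B *ᵥ u)) ⬝ᵥ (Bᵀ *ᵥ (B *ᵥ u)))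
    {j : Fin rz} (hj : V.col j = 0) {u : Fin ru → ℝ} (hu : Vᵀ *ᵥ (B *ᵥ u) = 0) : B *ᵥ u = 0 := by
  set w := B *ᵥ u with hw
  set β := w ᵥ* B with hβ
  set N := Z * B with hN
  set ej : Fin rz → ℝ := Pi.single j 1 with hej
  have hVej : V *ᵥ ej = 0 := by rw [hej, mulVec_single_one]; exact hj
  have hwV : w ᵥ* V = 0 := by rw [← mulVec_transpose]; exact hu
  have hNj : ej ᵥ* N = 0 := by
    have h1 : ej ᵥ* (γ • N) = 0 := by
      rw [h.smul_encoder_eq hγ hWV hDA hDB, ← vecMul_vecMul, vecMul_transpose, hVej, zero_vecMul]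
    rw [vecMul_smul] at h1
    exact (smul_eq_zero.1 h1).resolve_left hγ.ne'
  have hsj : s j ^ 2 = 1 := by
    have h1 := h.sq_mul_eq hγ hWV j
    rw [transpose_mul_self_apply_eq_zero.2 hj, add_zero] at h1
    exact (mul_eq_right₀ hγ.ne').1 h1
  set H := vecMulVec ej (w ᵥ* (1 - A * D)) with hH
  have hHA : H * A = 0 := by
    rw [hH, vecMulVec_mul, vecMul_vecMul, Matrix.sub_mul, Matrix.mul_assoc, hDA]
    simp [vecMulVec_zero_right]
  have hHB : H * B = vecMulVec ej β := by
    rw [hH, vecMulVec_mul, vecMul_vecMul, Matrix.sub_mul, Matrix.mul_assoc, hDB]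
    simp [hβ]
  have hev := h.eventually_le_of_mul_eq_zero (V' := fun t => V + t • vecMulVec w ej)
    (Z' := fun t => Z + (t / γ) • H) (s' := fun _ => s) (by fun_prop) (by fun_prop)
    continuousAt_const (by simp) (by simp) rfl
    (fun t => by rw [Matrix.add_mul, Matrix.smul_mul, hHA, h.Z_mul_A]; simp)
    (fun t => by
      have : Wy *ᵥ w = 0 := by rw [hw, mulVec_mulVec, hWB, zero_mulVec]
      rw [Matrix.mul_add, Matrix.mul_smul, mul_vecMulVec, hWV, this]
      simp)
  have hrank : ∀ (X : Matrix (Fin rx) (Fin ru) ℝ), frob X (vecMulVec w β) = (w ᵥ* X) ⬝ᵥ β :=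
    fun X => by
      rw [frob, mul_vecMulVec, trace_vecMulVec, mulVec_transpose]
  have hjj : ej ⬝ᵥ ej = 1 := by simp [hej]
  have hle : (1 / γ) * ((β ⬝ᵥ β) / γ - w ⬝ᵥ w) ≤ 0 := by
    refine nonpos_of_eventually_le_pow_mul two_ne_zero
      (b := (1 / γ) * ((w ⬝ᵥ w) * (β ⬝ᵥ β) / γ ^ 2)) ?_
    filter_upwards [hev, self_mem_nhdsWithin] with t ht ht0
    have e1 : (Z + (t / γ) • H) * B = N + (t / γ) • vecMulVec ej β := by
      rw [Matrix.add_mul, Matrix.smul_mul, hHB]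
    have e2 : B - (V + t • vecMulVec w ej) * (N + (t / γ) • vecMulVec ej β) =
        (B - V * N) + (-(t ^ 2 / γ)) • vecMulVec w β := by
      have g1 : V * vecMulVec ej β = 0 := by rw [mul_vecMulVec, hVej, zero_vecMulVec]
      have g2 : vecMulVec w ej * N = 0 := by rw [vecMulVec_mul, hNj, vecMulVec_zero_right]
      simp only [Matrix.add_mul, Matrix.mul_add, Matrix.smul_mul, Matrix.mul_smul, g1, g2,
        vecMulVec_mul_vecMulVec_eq, hjj]
      have : t ^ 2 / γ = t / γ * t := by ring
      rw [this]
      module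
    have e3 : frob (B - V * N) (vecMulVec w β) = β ⬝ᵥ β := by
      rw [hrank, vecMul_sub, ← vecMul_vecMul, hwV, zero_vecMul, sub_zero]
    have e4 : frob (vecMulVec w β) (vecMulVec w β) = (w ⬝ᵥ w) * (β ⬝ᵥ β) := by
      rw [hrank, vecMul_vecMulVec, smul_dotProduct, smul_eq_mul]
    have e5 : frob (N + (t / γ) • vecMulVec ej β) (N + (t / γ) • vecMulVec ej β) =
        frob N N + (t / γ) ^ 2 * (β ⬝ᵥ β) := by
      have g1 : frob N (vecMulVec ej β) = 0 := by
        rw [frob, mul_vecMulVec, trace_vecMulVec, mulVec_transpose, hNj, zero_dotProduct]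
      have g2 : frob (vecMulVec ej β) (vecMulVec ej β) = β ⬝ᵥ β := by
        rw [frob, mul_vecMulVec, trace_vecMulVec, mulVec_transpose, vecMul_vecMulVec, hjj, one_smul]
      rw [frob_add_smul_self, g1, g2]
      ring
    have e6 : (V + t • vecMulVec w ej)ᵀ * (V + t • vecMulVec w ej) =
        Vᵀ * V + (t ^ 2 * (w ⬝ᵥ w)) • vecMulVec ej ej := by
      have g1 : Vᵀ * vecMulVec w ej = 0 := by rw [mul_vecMulVec, hu, zero_vecMulVec]
      have g2 : vecMulVec ej w * V = 0 := by rw [vecMulVec_mul, hwV, vecMulVec_zero_right]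
      simp only [transpose_add, transpose_smul, transpose_vecMulVec, Matrix.add_mul,
        Matrix.mul_add, Matrix.smul_mul, Matrix.mul_smul, g1, g2, vecMulVec_mul_vecMulVec_eq]
      module
    have e7 : ∑ k, s k ^ 2 * ((V + t • vecMulVec w ej)ᵀ * (V + t • vecMulVec w ej)) k k =
        ∑ k, s k ^ 2 * (Vᵀ * V) k k + t ^ 2 * (w ⬝ᵥ w) := by
      rw [e6]
      simp only [Matrix.add_apply, Matrix.smul_apply, vecMulVec_apply, mul_add,
        Finset.sum_add_distrib]
      congr 1
      rw [Finset.sum_eq_single j (fun k _ hk => by simp [hej, hk]) (by simp)]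
      simp [hej, hsj]
    rw [e1, e2, e7, e5, frob_add_smul_self, e3, e4] at ht
    have h2 : t ^ 2 * ((1 / γ) * ((β ⬝ᵥ β) / γ - w ⬝ᵥ w)) ≤
        t ^ 2 * (t ^ 2 * ((1 / γ) * ((w ⬝ᵥ w) * (β ⬝ᵥ β) / γ ^ 2))) := by
      have e8 : t ^ 2 * ((1 / γ) * ((β ⬝ᵥ β) / γ - w ⬝ᵥ w)) =
        -((1 / γ) * (2 * (-(t ^ 2 / γ)) * (β ⬝ᵥ β)) + (1 / γ) * (t ^ 2 * (w ⬝ᵥ w)) +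
          (t / γ) ^ 2 * (β ⬝ᵥ β)) := by ring
      have e9 : t ^ 2 * (t ^ 2 * ((1 / γ) * ((w ⬝ᵥ w) * (β ⬝ᵥ β) / γ ^ 2))) =
        (1 / γ) * ((-(t ^ 2 / γ)) ^ 2 * ((w ⬝ᵥ w) * (β ⬝ᵥ β))) := by field_simp
      rw [e8, e9]
      linarith
    exact le_of_mul_le_mul_left h2 (pow_pos ht0 2)
  have hle' := nonpos_of_mul_nonpos_right hle (by positivity)
  have hβw : β ⬝ᵥ β ≤ γ * (w ⬝ᵥ w) := by
    have : (β ⬝ᵥ β) / γ ≤ w ⬝ᵥ w := by linarith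
    rw [div_le_iff₀ hγ] at this
    linarith
  have hlow := hδ u
  rw [← hw, mulVec_transpose, ← hβ] at hlow
  have hww : 0 ≤ w ⬝ᵥ w := Finset.sum_nonneg fun _ _ => mul_self_nonneg _
  exact dotProduct_self_eq_zero.1 (le_antisymm (by nlinarith) hww)

/-- For small `γ` the columns of the decoder weight span the column space of `B`. If no column
vanishes, they are `rz ≥ rank B` independent vectors of that space; otherwise
`eq_zero_of_vecMul_eq_zero` applies. -/
theorem range_le (h : IsReducedMinimum γ A B Wy V Z s) (hγ : 0 < γ)
    (hWB : Wy * B = 0) (hDA : D * A = 1) (hDB : D * B = 0) (hX : Bᵀ * B * X₀ = Bᵀ) (hγδ : γ < δ)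
    (hδ : ∀ u, δ * ((B *ᵥ u) ⬝ᵥ (B *ᵥ u)) ≤ (Bᵀ *ᵥ (B *ᵥ u)) ⬝ᵥ (Bᵀ *ᵥ (B *ᵥ u)))
    (hrz : B.rank ≤ rz) :
    LinearMap.range B.mulVecLin ≤ LinearMap.range V.mulVecLin := by
  have hBV := h.mul_normal_equation hγ hWB hX
  have hWV : Wy * V = 0 := by
    rw [← hBV, Matrix.mul_assoc, ← Matrix.mul_assoc, hWB, Matrix.zero_mul]
  have hproj := transpose_mul_orthogonal_projection fun i j hij =>
    h.transpose_mul_self_apply_of_ne hγ hWV (i := i) (j := j) hij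
  by_cases hz : ∃ j, V.col j = 0
  · obtain ⟨j, hj⟩ := hz
    rintro _ ⟨u, rfl⟩
    set G := Matrix.diagonal (fun k => ((Vᵀ * V) k k)⁻¹) with hG
    have hu := h.eq_zero_of_vecMul_eq_zero hγ hWB hWV hDA hDB hγδ hδ hj
      (u := u - (X₀ * V * G * Vᵀ * B) *ᵥ u) (by
        have e1 : B *ᵥ (u - (X₀ * V * G * Vᵀ * B) *ᵥ u) = (B - V * G * Vᵀ * B) *ᵥ u := by
          rw [mulVec_sub, sub_mulVec, mulVec_mulVec]
          simp only [← Matrix.mul_assoc, hBV]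
        rw [e1, mulVec_mulVec, Matrix.mul_sub]
        simp only [← Matrix.mul_assoc]
        rw [hproj, sub_self, zero_mulVec])
    refine ⟨(G * Vᵀ * B) *ᵥ u, ?_⟩
    rw [mulVec_sub, sub_eq_zero, mulVec_mulVec] at hu
    simp only [← Matrix.mul_assoc, hBV] at hu
    simp only [mulVecLin_apply, mulVec_mulVec, ← Matrix.mul_assoc]
    exact hu.symm
  · push Not at hz
    have hle : LinearMap.range V.mulVecLin ≤ LinearMap.range B.mulVecLin := by
      rintro _ ⟨v, rfl⟩
      refine ⟨(X₀ * V) *ᵥ v, ?_⟩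
      simp [← Matrix.mul_assoc, hBV]
    have hinj : Function.Injective V.mulVecLin := by
      rw [injective_iff_map_eq_zero]
      intro v hv
      funext k
      have h1 := congrFun (congrArg (Vᵀ *ᵥ ·) hv) k
      simp only [mulVecLin_apply, mulVec_mulVec, mulVec_zero, Pi.zero_apply] at h1
      have h2 : ((Vᵀ * V) *ᵥ v) k = (Vᵀ * V) k k * v k := by
        refine Finset.sum_eq_single k (fun l _ hl => ?_)
          fun hk => absurd (Finset.mem_univ k) hk
        change (Vᵀ * V) k l * v l = 0
        rw [h.transpose_mul_self_apply_of_ne hγ hWV hl.symm, zero_mul]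
      rw [h2] at h1
      exact (mul_eq_zero.1 h1).resolve_left fun h0 => hz k (transpose_mul_self_apply_eq_zero.1 h0)
    refine (Submodule.eq_of_le_of_finrank_le hle ?_).ge
    rw [LinearMap.finrank_range_of_inj hinj]
    simpa [Matrix.rank] using hrz

end IsReducedMinimum

end CycleCVAE

namespace CycleCVAE

/-! ### A closed description of the minima -/

/-- Properties shared by the local minima for decoder variance `γ`, stated so that they survive
limits. Here `δ > γ` is a lower bound for the nonzero eigenvalues of `B Bᵀ`, and `X₀` solves
`Bᵀ B X₀ = Bᵀ`. The length of a nonzero column of `V_x` is bounded away from `0`, so that the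
alternative in `used_or_pruned` is a closed condition. -/
structure IsOptimal {rx ry ru rz : ℕ} (γ δ : ℝ) (A : Matrix (Fin rx) (Fin ry) ℝ)
    (B : Matrix (Fin rx) (Fin ru) ℝ) (c : Fin rx → ℝ) (X₀ : Matrix (Fin ru) (Fin rx) ℝ)
    (p : Params rx ry rz) : Prop where
  Wy_mul_A : p.Wy * A = 1
  Wy_mul_B : p.Wy * B = 0
  bY_eq : p.bY = -(p.Wy *ᵥ c)
  Wx_eq : p.Wx = A
  Wz_mul_A : p.Wz * A = 0
  bz_eq : p.bz = -(p.Wz *ᵥ c)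
  projection_Vx : B * X₀ * p.Vx = p.Vx
  orthogonal : ∀ i j, i ≠ j → (p.Vxᵀ * p.Vx) i j = 0
  Vx_mul_transpose : p.Vx * p.Vxᵀ * B = B * Bᵀ * B - γ • B
  used_or_pruned : ∀ k, (p.Vx.col k = 0 ∧ (p.Wz * B).row k = 0 ∧ p.s k ^ 2 = 1) ∨
    (δ - γ ≤ (p.Vxᵀ * p.Vx) k k ∧
      ((p.Vxᵀ * p.Vx) k k + γ) • (p.Wz * B).row k = (p.Vxᵀ * B).row k)

namespace Params

variable {rx ry rz : ℕ}

theorem continuous_toProd : Continuous (toProd (rx := rx) (ry := ry) (rz := rz)) :=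
  continuous_induced_dom

@[fun_prop]
theorem continuous_Wx : Continuous fun p : Params rx ry rz => p.Wx :=
  continuous_fst.comp continuous_toProd

@[fun_prop]
theorem continuous_Vx : Continuous fun p : Params rx ry rz => p.Vx :=
  (continuous_fst.comp continuous_snd).comp continuous_toProd

@[fun_prop]
theorem continuous_Wy : Continuous fun p : Params rx ry rz => p.Wy :=
  (by fun_prop : Continuous fun w : Matrix (Fin rx) (Fin ry) ℝ × Matrix (Fin rx) (Fin rz) ℝ ×
    (Fin rx → ℝ) × Matrix (Fin ry) (Fin rx) ℝ × (Fin ry → ℝ) × Matrix (Fin rz) (Fin rx) ℝ ×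
      (Fin rz → ℝ) × (Fin rz → ℝ) => w.2.2.2.1).comp continuous_toProd

@[fun_prop]
theorem continuous_bY : Continuous fun p : Params rx ry rz => p.bY :=
  (by fun_prop : Continuous fun w : Matrix (Fin rx) (Fin ry) ℝ × Matrix (Fin rx) (Fin rz) ℝ ×
    (Fin rx → ℝ) × Matrix (Fin ry) (Fin rx) ℝ × (Fin ry → ℝ) × Matrix (Fin rz) (Fin rx) ℝ ×
      (Fin rz → ℝ) × (Fin rz → ℝ) => w.2.2.2.2.1).comp continuous_toProd

@[fun_prop]
theorem continuous_Wz : Continuous fun p : Params rx ry rz => p.Wz :=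
  (by fun_prop : Continuous fun w : Matrix (Fin rx) (Fin ry) ℝ × Matrix (Fin rx) (Fin rz) ℝ ×
    (Fin rx → ℝ) × Matrix (Fin ry) (Fin rx) ℝ × (Fin ry → ℝ) × Matrix (Fin rz) (Fin rx) ℝ ×
      (Fin rz → ℝ) × (Fin rz → ℝ) => w.2.2.2.2.2.1).comp continuous_toProd

@[fun_prop]
theorem continuous_bz : Continuous fun p : Params rx ry rz => p.bz :=
  (by fun_prop : Continuous fun w : Matrix (Fin rx) (Fin ry) ℝ × Matrix (Fin rx) (Fin rz) ℝ ×
    (Fin rx → ℝ) × Matrix (Fin ry) (Fin rx) ℝ × (Fin ry → ℝ) × Matrix (Fin rz) (Fin rx) ℝ ×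
      (Fin rz → ℝ) × (Fin rz → ℝ) => w.2.2.2.2.2.2.1).comp continuous_toProd

@[fun_prop]
theorem continuous_s : Continuous fun p : Params rx ry rz => p.s :=
  (by fun_prop : Continuous fun w : Matrix (Fin rx) (Fin ry) ℝ × Matrix (Fin rx) (Fin rz) ℝ ×
    (Fin rx → ℝ) × Matrix (Fin ry) (Fin rx) ℝ × (Fin ry → ℝ) × Matrix (Fin rz) (Fin rx) ℝ ×
      (Fin rz → ℝ) × (Fin rz → ℝ) => w.2.2.2.2.2.2.2).comp continuous_toProd

end Params

variable {rx ry ru rz : ℕ} {A : Matrix (Fin rx) (Fin ry) ℝ} {B : Matrix (Fin rx) (Fin ru) ℝ}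
  {c : Fin rx → ℝ} {D : Matrix (Fin ry) (Fin rx) ℝ} {e : Fin ry → ℝ}
  {X₀ : Matrix (Fin ru) (Fin rx) ℝ} {γ δ : ℝ} {p : Params rx ry rz}

theorem isClosed_isOptimal (δ : ℝ) (A : Matrix (Fin rx) (Fin ry) ℝ)
    (B : Matrix (Fin rx) (Fin ru) ℝ) (c : Fin rx → ℝ) (X₀ : Matrix (Fin ru) (Fin rx) ℝ) :
    IsClosed {w : ℝ × Params rx ry rz | IsOptimal w.1 δ A B c X₀ w.2} := by
  have hn : ∀ i j, Continuous fun w : ℝ × Params rx ry rz => (w.2.Vxᵀ * w.2.Vx) i j := fun i j =>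
    (by fun_prop : Continuous fun w : ℝ × Params rx ry rz => w.2.Vxᵀ * w.2.Vx).matrix_elem i j
  have hcol : ∀ k, Continuous fun w : ℝ × Params rx ry rz => w.2.Vx.col k := fun k =>
    continuous_pi fun i => (by fun_prop : Continuous fun w : ℝ × Params rx ry rz =>
      w.2.Vx).matrix_elem i k
  have hN : ∀ k, Continuous fun w : ℝ × Params rx ry rz => (w.2.Wz * B).row k := fun k =>
    continuous_pi fun i => (by fun_prop : Continuous fun w : ℝ × Params rx ry rz =>
      w.2.Wz * B).matrix_elem k i
  have hVB : ∀ k, Continuous fun w : ℝ × Params rx ry rz => (w.2.Vxᵀ * B).row k := fun k =>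
    continuous_pi fun i => (by fun_prop : Continuous fun w : ℝ × Params rx ry rz =>
      w.2.Vxᵀ * B).matrix_elem k i
  have hs : ∀ k, Continuous fun w : ℝ × Params rx ry rz => w.2.s k := fun k => by fun_prop
  have c1 : IsClosed {w : ℝ × Params rx ry rz | w.2.Wy * A = 1} :=
    isClosed_eq (by fun_prop) (by fun_prop)
  have c2 : IsClosed {w : ℝ × Params rx ry rz | w.2.Wy * B = 0} :=
    isClosed_eq (by fun_prop) (by fun_prop)
  have c3 : IsClosed {w : ℝ × Params rx ry rz | w.2.bY = -(w.2.Wy *ᵥ c)} :=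
    isClosed_eq (by fun_prop) (by fun_prop)
  have c4 : IsClosed {w : ℝ × Params rx ry rz | w.2.Wx = A} :=
    isClosed_eq (by fun_prop) (by fun_prop)
  have c5 : IsClosed {w : ℝ × Params rx ry rz | w.2.Wz * A = 0} :=
    isClosed_eq (by fun_prop) (by fun_prop)
  have c6 : IsClosed {w : ℝ × Params rx ry rz | w.2.bz = -(w.2.Wz *ᵥ c)} :=
    isClosed_eq (by fun_prop) (by fun_prop)
  have c7 : IsClosed {w : ℝ × Params rx ry rz | B * X₀ * w.2.Vx = w.2.Vx} :=
    isClosed_eq (by fun_prop) (by fun_prop)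
  have c8 : IsClosed (⋂ i, ⋂ j, ⋂ (_ : i ≠ j),
      {w : ℝ × Params rx ry rz | (w.2.Vxᵀ * w.2.Vx) i j = 0}) :=
    isClosed_iInter fun i => isClosed_iInter fun j => isClosed_iInter fun _ =>
      isClosed_eq (hn i j) continuous_const
  have c9 : IsClosed {w : ℝ × Params rx ry rz |
      w.2.Vx * w.2.Vxᵀ * B = B * Bᵀ * B - w.1 • B} :=
    isClosed_eq (by fun_prop) (by fun_prop)
  have c10 : IsClosed (⋂ k, (({w : ℝ × Params rx ry rz | w.2.Vx.col k = 0} ∩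
      ({w | (w.2.Wz * B).row k = 0} ∩ {w | w.2.s k ^ 2 = 1})) ∪
      ({w | δ - w.1 ≤ (w.2.Vxᵀ * w.2.Vx) k k} ∩
        {w | ((w.2.Vxᵀ * w.2.Vx) k k + w.1) • (w.2.Wz * B).row k = (w.2.Vxᵀ * B).row k}))) :=
    isClosed_iInter fun k => IsClosed.union
      ((isClosed_eq (hcol k) continuous_const).inter
        ((isClosed_eq (hN k) continuous_const).inter
          (isClosed_eq ((hs k).pow 2) continuous_const)))
      ((isClosed_le (by fun_prop) (hn k k)).inter
        (isClosed_eq (((hn k k).add continuous_fst).smul (hN k)) (hVB k)))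
  convert c1.inter (c2.inter (c3.inter (c4.inter (c5.inter (c6.inter (c7.inter (c8.inter
    (c9.inter c10)))))))) using 1
  ext w
  simp only [mem_inter_iff, mem_iInter, mem_union]
  exact ⟨fun h => ⟨h.1, h.2, h.3, h.4, h.5, h.6, h.7, h.8, h.9, h.10⟩,
    fun ⟨h1, h2, h3, h4, h5, h6, h7, h8, h9, h10⟩ => ⟨h1, h2, h3, h4, h5, h6, h7, h8, h9, h10⟩⟩

theorem IsAffineSurjectiveModel.isOptimal_of_isMinimum {Ω : Type*} [MeasurableSpace Ω]
    {μ : Measure Ω} [IsProbabilityMeasure μ] {Y : Ω → Fin ry → ℝ} {U : Ω → Fin ru → ℝ}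
    (hmodel : IsAffineSurjectiveModel μ A B c D e Y U) (hX : Bᵀ * B * X₀ = Bᵀ)
    (hδ : ∀ u, δ * ((B *ᵥ u) ⬝ᵥ (B *ᵥ u)) ≤ (Bᵀ *ᵥ (B *ᵥ u)) ⬝ᵥ (Bᵀ *ᵥ (B *ᵥ u)))
    (hrz : B.rank ≤ rz) (hγ : 0 < γ) (hγδ : γ < δ)
    (hp : p.IsMinimum (lawX μ A B c Y U) (μ.map Y) γ) : IsOptimal γ δ A B c X₀ p := by
  obtain ⟨-, h1, h2, h3⟩ := (hmodel.mem_feasible_iff p).1 hp.1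
  obtain ⟨hWx, -, hWz, hbz⟩ := hmodel.eq_of_isMinimum hγ hp
  have h := hmodel.isReducedMinimum hγ hp
  have hBV := h.mul_normal_equation hγ h2 hX
  have hWV : p.Wy * p.Vx = 0 := by
    rw [← hBV, Matrix.mul_assoc, ← Matrix.mul_assoc, h2, Matrix.zero_mul]
  have hort : ∀ i j, i ≠ j → (p.Vxᵀ * p.Vx) i j = 0 := fun i j hij =>
    h.transpose_mul_self_apply_of_ne hγ hWV hij
  have hs := h.sq_mul_eq hγ hWV
  have henc := h.smul_encoder_eq hγ hWV hmodel.D_mul_A hmodel.D_mul_B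
  have hdec := h.residual_mul_transpose hγ h2 hWV
  obtain ⟨X, hVX⟩ := exists_mul_eq_of_range_le
    (h.range_le hγ h2 hmodel.D_mul_A hmodel.D_mul_B hX hγδ hδ hrz)
  have hd := transpose_mul_self_eq_diagonal hort
  set V := p.Vx with hV
  set N := p.Wz * B with hN
  set n : Fin rz → ℝ := fun k => (Vᵀ * V) k k with hn
  have hn0 : ∀ k, 0 ≤ n k := fun k => transpose_mul_self_apply_nonneg V k
  have hVB : Vᵀ * B = (Matrix.diagonal fun k => n k + γ) * N := by
    have e1 : (Matrix.diagonal fun k => n k + γ) = Vᵀ * V + γ • (1 : Matrix _ _ ℝ) := by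
      rw [hd, smul_one_eq_diagonal, Matrix.diagonal_add]
    rw [e1, Matrix.add_mul, Matrix.smul_mul, Matrix.one_mul, henc, Matrix.mul_sub,
      Matrix.mul_assoc]
    abel
  have hNN : γ • (N * Nᵀ) = Matrix.diagonal fun k => n k * p.s k ^ 2 := by
    rw [← Matrix.smul_mul, henc, Matrix.mul_assoc, hdec, ← Matrix.mul_assoc, hd,
      Matrix.diagonal_mul_diagonal]
  have hK : Vᵀ * B * (Vᵀ * B)ᵀ = Vᵀ * V * (Vᵀ * V) + γ • (Vᵀ * V) := by
    have e1 : γ • (Vᵀ * B * (Vᵀ * B)ᵀ) = γ • (Vᵀ * V * (Vᵀ * V) + γ • (Vᵀ * V)) := by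
      rw [hVB, transpose_mul, diagonal_transpose, Matrix.mul_assoc, ← Matrix.mul_assoc N,
        ← Matrix.mul_smul, ← Matrix.smul_mul, hNN, hd, Matrix.diagonal_mul_diagonal,
        Matrix.diagonal_mul_diagonal, Matrix.diagonal_mul_diagonal, ← Matrix.diagonal_smul,
        Matrix.diagonal_add, ← Matrix.diagonal_smul]
      congr 1
      funext k
      simp only [Pi.smul_apply, smul_eq_mul]
      linear_combination (n k + γ) * n k * hs k
    exact smul_right_injective _ hγ.ne' e1
  refine ⟨h1, h2, h3, hWx, hWz, hbz, hBV, hort, ?_, fun k => ?_⟩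
  · have hT : (B * Bᵀ - V * Vᵀ - γ • (1 : Matrix _ _ ℝ)) * V = 0 := by
      set T := (B * Bᵀ - V * Vᵀ - γ • (1 : Matrix _ _ ℝ)) * V with hT
      have e1 : Vᵀ * T = 0 := by
        have : Vᵀ * T = Vᵀ * B * (Vᵀ * B)ᵀ - Vᵀ * V * (Vᵀ * V) - γ • (Vᵀ * V) := by
          rw [hT, transpose_mul, transpose_transpose]
          simp only [Matrix.sub_mul, Matrix.mul_sub, Matrix.mul_assoc, Matrix.smul_mul,
            Matrix.mul_smul, Matrix.one_mul]
        rw [this, hK]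
        abel
      have e2 : T = V * (X * (Bᵀ * V) - Vᵀ * V - γ • (1 : Matrix _ _ ℝ)) := by
        have : V * (X * (Bᵀ * V)) = B * (Bᵀ * V) := by rw [← Matrix.mul_assoc, hVX]
        rw [Matrix.mul_sub, Matrix.mul_sub, this, hT]
        simp only [Matrix.sub_mul, Matrix.mul_assoc, Matrix.smul_mul, Matrix.mul_smul,
          Matrix.one_mul, Matrix.mul_one]
      refine frob_self_eq_zero.1 ?_
      conv_lhs => rw [e2]
      rw [frob_mul_left, ← e2, e1]
      simp [frob]
    have hTX := congrArg (· * X) hT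
    simp only [Matrix.mul_assoc, hVX, Matrix.zero_mul, Matrix.sub_mul, Matrix.smul_mul,
      Matrix.one_mul] at hTX
    rw [sub_right_comm, sub_eq_zero] at hTX
    rw [Matrix.mul_assoc, Matrix.mul_assoc]
    exact hTX.symm
  · have hrow : (n k + γ) • N.row k = (Vᵀ * B).row k := by
      rw [hVB]
      ext i
      simp [Matrix.diagonal_mul]
    rcases (hn0 k).eq_or_lt with h0 | hpos
    · left
      have hcol := transpose_mul_self_apply_eq_zero.1 h0.symm
      have hrow0 : (Vᵀ * B).row k = 0 := by
        ext i
        have : ∀ a, V a k = 0 := fun a => congrFun hcol a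
        simp [Matrix.mul_apply, this]
      have hsk := hs k
      rw [show (Vᵀ * V) k k = 0 from h0.symm, add_zero] at hsk
      rw [hrow0, ← h0, zero_add] at hrow
      exact ⟨hcol, (smul_eq_zero.1 hrow).resolve_left hγ.ne', (mul_eq_right₀ hγ.ne').1 hsk⟩
    · right
      refine ⟨?_, hrow⟩
      have hlow := hδ ((X₀ * V).col k)
      have e1 : B *ᵥ (X₀ * V).col k = V.col k := by
        conv_rhs => rw [← hBV]
        rw [Matrix.mul_assoc]
        rfl
      have e2 : (Bᵀ *ᵥ V.col k) ⬝ᵥ (Bᵀ *ᵥ V.col k) = (Vᵀ * B * (Vᵀ * B)ᵀ) k k := by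
        rw [transpose_mul, transpose_transpose]
        have : (Vᵀ * B).row k = Bᵀ *ᵥ V.col k := by
          rw [mulVec_transpose]
          rfl
        rw [← this]
        have h4 : Bᵀ * V = (Vᵀ * B)ᵀ := by simp
        rw [h4]
        rfl
      have e3 : (Vᵀ * V * (Vᵀ * V) + γ • (Vᵀ * V)) k k = n k * (n k + γ) := by
        rw [hd, Matrix.diagonal_mul_diagonal, ← Matrix.diagonal_smul, Matrix.diagonal_add,
          Matrix.diagonal_apply_eq]
        simp only [Pi.smul_apply, smul_eq_mul]
        ring
      rw [e1, e2, hK, e3] at hlow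
      have e4 : V.col k ⬝ᵥ V.col k = n k := rfl
      rw [e4, mul_comm] at hlow
      have := le_of_mul_le_mul_left hlow hpos
      change δ - γ ≤ n k
      linarith

end CycleCVAE

namespace CycleCVAE

/-! ### Sorting the latent dimensions -/

theorem exists_equiv_sum {m r : ℕ} (P : Fin m → Prop) [DecidablePred P]
    (h : Fintype.card {k // P k} = r) :
    ∃ σ : Fin m ≃ Fin r ⊕ Fin (m - r),
      (∀ i, P (σ.symm (Sum.inl i))) ∧ ∀ j, ¬ P (σ.symm (Sum.inr j)) := by
  have h' : Fintype.card {k // ¬ P k} = m - r := by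
    rw [Fintype.card_subtype_compl, h, Fintype.card_fin]
  refine ⟨(Equiv.sumCompl P).symm.trans
    (Equiv.sumCongr (Fintype.equivFinOfCardEq h) (Fintype.equivFinOfCardEq h')),
    fun i => ?_, fun j => ?_⟩
  · simpa using ((Fintype.equivFinOfCardEq h).symm i).2
  · simpa using ((Fintype.equivFinOfCardEq h').symm j).2

section Permutation

/-- A matrix whose columns with index in the second summand vanish acts through the others. -/
theorem mulVec_eq_submatrix_mulVec {l m a b : Type*} [Fintype m] [Fintype a] [Fintype b]
    (V : Matrix l m ℝ) (σ : m ≃ a ⊕ b) (hV : ∀ j, V.col (σ.symm (Sum.inr j)) = 0) (v : m → ℝ) :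
    V *ᵥ v = V.submatrix id (fun i => σ.symm (Sum.inl i)) *ᵥ fun i => v (σ.symm (Sum.inl i)) := by
  ext x
  simp only [mulVec, dotProduct, submatrix_apply, id]
  rw [← σ.symm.sum_comp, Fintype.sum_sum_type, add_eq_left]
  refine Finset.sum_eq_zero fun j _ => ?_
  have := congrFun (hV j) x
  rw [col_apply] at this
  simp [this]
variable {m n : Type*} [DecidableEq m] [DecidableEq n] [Fintype n]

theorem permMatrix_mul_apply {l : Type*} (σ : m ≃ n) (M : Matrix n l ℝ) (i : m) (j : l) :
    (permMatrix σ * M) i j = M (σ i) j := by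
  simp [permMatrix, Matrix.mul_apply]

theorem permMatrix_mulVec_apply (σ : m ≃ n) (f : n → ℝ) (i : m) :
    (permMatrix σ *ᵥ f) i = f (σ i) := by
  simp [permMatrix, mulVec, dotProduct]

theorem mul_permMatrix_transpose_apply {l : Type*} (σ : m ≃ n) (M : Matrix l n ℝ) (i : l)
    (k : m) : (M * (permMatrix σ)ᵀ) i k = M i (σ k) := by
  simp [permMatrix, Matrix.mul_apply]

end Permutation

/-! ### Consequences of optimality -/

namespace IsOptimal

variable {rx ry ru rz : ℕ} {A : Matrix (Fin rx) (Fin ry) ℝ} {B : Matrix (Fin rx) (Fin ru) ℝ}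
  {c : Fin rx → ℝ} {D : Matrix (Fin ry) (Fin rx) ℝ}
  {X₀ : Matrix (Fin ru) (Fin rx) ℝ} {γ δ : ℝ} {p : Params rx ry rz}

/-- The orthogonal projection onto the column space of `V_x` fixes the columns of `B`. A vector `w`
of the column space of `B` with `V_xᵀ w = 0` satisfies `Bᵀ B (Bᵀ w) = γ Bᵀ w`, and `γ` is below the
nonzero eigenvalues of `Bᵀ B`. -/
theorem projection_B (h : IsOptimal γ δ A B c X₀ p) (hγδ : γ < δ)
    (hδ : ∀ u, δ * ((B *ᵥ u) ⬝ᵥ (B *ᵥ u)) ≤ (Bᵀ *ᵥ (B *ᵥ u)) ⬝ᵥ (Bᵀ *ᵥ (B *ᵥ u)))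
    (hδ0 : 0 < δ) :
    p.Vx * Matrix.diagonal (fun k => ((p.Vxᵀ * p.Vx) k k)⁻¹) * p.Vxᵀ * B = B := by
  set V := p.Vx with hV
  set G := Matrix.diagonal (fun k => ((Vᵀ * V) k k)⁻¹) with hG
  have hproj := transpose_mul_orthogonal_projection h.orthogonal
  rw [← hV, ← hG] at hproj
  have hBV := h.projection_Vx
  rw [← hV] at hBV
  refine ext_of_mulVec_single fun i => ?_
  set u : Fin ru → ℝ := Pi.single i 1
  set w := B *ᵥ (u - (X₀ * V * G * Vᵀ * B) *ᵥ u) with hw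
  have hw' : w = B *ᵥ u - (V * G * Vᵀ * B) *ᵥ u := by
    rw [hw, mulVec_sub, mulVec_mulVec]
    simp only [← Matrix.mul_assoc, hBV]
  have hVw : Vᵀ *ᵥ w = 0 := by
    rw [hw', mulVec_sub, mulVec_mulVec, mulVec_mulVec]
    simp only [← Matrix.mul_assoc]
    rw [hproj, sub_self]
  have heig : Bᵀ *ᵥ (B *ᵥ (Bᵀ *ᵥ w)) = γ • (Bᵀ *ᵥ w) := by
    have h1 := congrArg (fun M => Mᵀ *ᵥ w) h.Vx_mul_transpose
    simp only [transpose_mul, transpose_sub, transpose_smul, transpose_transpose, sub_mulVec,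
      smul_mulVec, ← mulVec_mulVec] at h1
    rw [← hV, hVw] at h1
    simp only [mulVec_zero] at h1
    exact sub_eq_zero.1 h1.symm
  have hdot : ∀ (x : Fin ru → ℝ) (z : Fin rx → ℝ), x ⬝ᵥ (Bᵀ *ᵥ z) = (B *ᵥ x) ⬝ᵥ z := fun x z => by
    rw [dotProduct_mulVec, vecMul_transpose]
  have hsq : ∀ {n : ℕ} (x : Fin n → ℝ), 0 ≤ x ⬝ᵥ x := fun x =>
    Finset.sum_nonneg fun _ _ => mul_self_nonneg _
  set y := Bᵀ *ᵥ w with hy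
  have hBy : B *ᵥ y = 0 := by
    have h1 := hδ y
    have h2 : (γ • y) ⬝ᵥ (γ • y) = γ * ((B *ᵥ y) ⬝ᵥ (B *ᵥ y)) := by
      rw [← hdot, heig, smul_dotProduct, smul_eq_mul]
    rw [heig, h2] at h1
    have h3 := hsq (B *ᵥ y)
    exact dotProduct_self_eq_zero.1 (le_antisymm (by nlinarith) h3)
  have hy0 : y = 0 := by
    refine dotProduct_self_eq_zero.1 ?_
    conv_lhs => rw [hy]
    rw [hdot, ← hy, hBy, zero_dotProduct]
  have hw0 : w = 0 := by
    have h1 := hδ (u - (X₀ * V * G * Vᵀ * B) *ᵥ u)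
    rw [← hw, ← hy, hy0, zero_dotProduct] at h1
    exact dotProduct_self_eq_zero.1 (le_antisymm (by nlinarith) (hsq w))
  rw [hw', sub_eq_zero] at hw0
  exact hw0.symm

theorem range_Vx (h : IsOptimal γ δ A B c X₀ p) (hγδ : γ < δ)
    (hδ : ∀ u, δ * ((B *ᵥ u) ⬝ᵥ (B *ᵥ u)) ≤ (Bᵀ *ᵥ (B *ᵥ u)) ⬝ᵥ (Bᵀ *ᵥ (B *ᵥ u)))
    (hδ0 : 0 < δ) : LinearMap.range p.Vx.mulVecLin = LinearMap.range B.mulVecLin := by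
  refine le_antisymm ?_ ?_
  · rintro _ ⟨v, rfl⟩
    refine ⟨(X₀ * p.Vx) *ᵥ v, ?_⟩
    simp only [mulVecLin_apply, mulVec_mulVec, ← Matrix.mul_assoc, h.projection_Vx]
  · rintro _ ⟨u, rfl⟩
    refine ⟨(Matrix.diagonal (fun k => ((p.Vxᵀ * p.Vx) k k)⁻¹) * p.Vxᵀ * B) *ᵥ u, ?_⟩
    simp only [mulVecLin_apply, mulVec_mulVec, ← Matrix.mul_assoc, h.projection_B hγδ hδ hδ0]

/-- As many latent dimensions are used as `B` has independent columns. -/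
theorem card_ne_zero (h : IsOptimal γ δ A B c X₀ p) (hγδ : γ < δ)
    (hδ : ∀ u, δ * ((B *ᵥ u) ⬝ᵥ (B *ᵥ u)) ≤ (Bᵀ *ᵥ (B *ᵥ u)) ⬝ᵥ (Bᵀ *ᵥ (B *ᵥ u)))
    (hδ0 : 0 < δ) : Fintype.card {k // (p.Vxᵀ * p.Vx) k k ≠ 0} = B.rank := by
  have h1 : (p.Vxᵀ * p.Vx).rank = B.rank := by
    rw [rank_transpose_mul_self, Matrix.rank, h.range_Vx hγδ hδ hδ0, Matrix.rank]
  rw [transpose_mul_self_eq_diagonal h.orthogonal, rank_diagonal] at h1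
  convert h1

theorem exists_sorted (h : IsOptimal γ δ A B c X₀ p) (hγ : 0 ≤ γ) (hγδ : γ < δ)
    (hδ : ∀ u, δ * ((B *ᵥ u) ⬝ᵥ (B *ᵥ u)) ≤ (Bᵀ *ᵥ (B *ᵥ u)) ⬝ᵥ (Bᵀ *ᵥ (B *ᵥ u)))
    (hDA : D * A = 1) (hDB : D * B = 0) :
      ∃ (σ : Fin rz ≃ Fin B.rank ⊕ Fin (rz - B.rank))
        (Bt : Matrix (Fin rx) (Fin B.rank) ℝ)
        (Wt : Matrix (Fin B.rank) (Fin rx) ℝ) (bt : Fin B.rank → ℝ)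
        (R : Matrix (Fin (rz - B.rank)) (Fin rx) ℝ) (r : Fin (rz - B.rank) → ℝ),
        p.Vx = Matrix.fromCols Bt 0 * (permMatrix σ)ᵀ ∧
        LinearMap.range Bt.mulVecLin = LinearMap.range B.mulVecLin ∧
        p.Wz = permMatrix σ * Matrix.fromRows Wt R ∧
        p.bz = permMatrix σ *ᵥ Sum.elim bt r ∧
        (∀ i, Wt i ≠ 0) ∧
        (∀ x ∈ dataSpace A B c, R *ᵥ x + r = 0) ∧
        (ry + B.rank = rx → R = 0 ∧ r = 0) ∧
        (∀ j, p.s (σ.symm (Sum.inr j)) ^ 2 = 1) ∧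
        (∀ y u, p.yhat (groundTruth A B c y u) = y) ∧
        Set.BijOn (fun x => (p.yhat x, Wt *ᵥ x + bt)) (dataSpace A B c) Set.univ ∧
        Set.InvOn
          (fun w : (Fin ry → ℝ) × (Fin B.rank → ℝ) =>
            p.Wx *ᵥ w.1 + p.Vx *ᵥ (permMatrix σ *ᵥ
              Sum.elim (fun k => (1 + γ / (Bt.col k ⬝ᵥ Bt.col k)) * w.2 k) 0) + c)
          (fun x => (p.yhat x, Wt *ᵥ x + bt)) (dataSpace A B c) Set.univ := by
  have hδ0 : 0 < δ := hγ.trans_lt hγδ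
  have hprojB := h.projection_B hγδ hδ hδ0
  have hrange := h.range_Vx hγδ hδ hδ0
  have hnn : ∀ k, 0 ≤ (p.Vxᵀ * p.Vx) k k := transpose_mul_self_apply_nonneg p.Vx
  obtain ⟨σ, hl, hr⟩ := exists_equiv_sum _ (h.card_ne_zero hγδ hδ hδ0)
  have hr : ∀ j, (p.Vxᵀ * p.Vx) (σ.symm (Sum.inr j)) (σ.symm (Sum.inr j)) = 0 := fun j =>
    not_not.1 (hr j)
  have hcol : ∀ j, p.Vx.col (σ.symm (Sum.inr j)) = 0 := fun j =>
    transpose_mul_self_apply_eq_zero.1 (hr j)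
  have hpruned : ∀ j, (p.Wz * B).row (σ.symm (Sum.inr j)) = 0 ∧
      p.s (σ.symm (Sum.inr j)) ^ 2 = 1 := fun j => by
    rcases h.used_or_pruned (σ.symm (Sum.inr j)) with h1 | h1
    · exact h1.2
    · rw [hr j] at h1
      linarith [h1.1]
  have hused : ∀ i, ((p.Vxᵀ * p.Vx) (σ.symm (Sum.inl i)) (σ.symm (Sum.inl i)) + γ) •
      (p.Wz * B).row (σ.symm (Sum.inl i)) = (p.Vxᵀ * B).row (σ.symm (Sum.inl i)) := fun i => by
    rcases h.used_or_pruned (σ.symm (Sum.inl i)) with h1 | h1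
    · exact absurd (transpose_mul_self_apply_eq_zero.2 h1.1) (hl i)
    · exact h1.2
  have hyhat := IsAffineSurjectiveModel.yhat_groundTruth h.Wy_mul_A h.Wy_mul_B h.bY_eq
  set Bt := p.Vx.submatrix id (fun i => σ.symm (Sum.inl i)) with hBt
  set Wt := p.Wz.submatrix (fun i => σ.symm (Sum.inl i)) id with hWt
  set R := p.Wz.submatrix (fun j => σ.symm (Sum.inr j)) id with hR
  set bt := fun i => p.bz (σ.symm (Sum.inl i)) with hbt
  set r := fun j => p.bz (σ.symm (Sum.inr j)) with hrdef
  have hVBt : ∀ v, p.Vx *ᵥ v = Bt *ᵥ fun i => v (σ.symm (Sum.inl i)) :=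
    mulVec_eq_submatrix_mulVec p.Vx σ hcol
  have hBtV : ∀ f, p.Vx *ᵥ (permMatrix σ *ᵥ Sum.elim f 0) = Bt *ᵥ f := fun f => by
    rw [hVBt]
    congr 1
    funext i
    simp [permMatrix_mulVec_apply]
  have hcc : ∀ k, Bt.col k ⬝ᵥ Bt.col k =
      (p.Vxᵀ * p.Vx) (σ.symm (Sum.inl k)) (σ.symm (Sum.inl k)) := fun k => rfl
  have hBX : ∀ v, B *ᵥ ((X₀ * p.Vx) *ᵥ v) = p.Vx *ᵥ v := fun v => by
    rw [mulVec_mulVec, ← Matrix.mul_assoc, h.projection_Vx]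
  -- on the data space the encoder mean only depends on `u`
  have hmean : ∀ y u k, (p.Wz *ᵥ groundTruth A B c y u + p.bz) k =
      (p.Wz * B).row k ⬝ᵥ u := fun y u k => by
    rw [groundTruth_mulVec, h.Wz_mul_A, h.bz_eq]
    simp [mulVec, row]
  have hWtx : ∀ y u i, (Wt *ᵥ groundTruth A B c y u + bt) i =
      (p.Wz * B).row (σ.symm (Sum.inl i)) ⬝ᵥ u := fun y u i => hmean y u _
  have hleft : Set.LeftInvOn (fun w : (Fin ry → ℝ) × (Fin B.rank → ℝ) =>
      p.Wx *ᵥ w.1 + p.Vx *ᵥ (permMatrix σ *ᵥ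
        Sum.elim (fun k => (1 + γ / (Bt.col k ⬝ᵥ Bt.col k)) * w.2 k) 0) + c)
      (fun x => (p.yhat x, Wt *ᵥ x + bt)) (dataSpace A B c) := by
    rintro _ ⟨y, u, rfl⟩
    simp only [hyhat, hBtV, h.Wx_eq]
    have hu : B *ᵥ u = Bt *ᵥ fun k => (1 + γ / (Bt.col k ⬝ᵥ Bt.col k)) *
        (Wt *ᵥ groundTruth A B c y u + bt) k := by
      conv_lhs => rw [← hprojB]
      rw [Matrix.mul_assoc, Matrix.mul_assoc, ← mulVec_mulVec, hVBt]
      congr 1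
      funext k
      rw [hWtx, hcc, ← mulVec_mulVec, mulVec_diagonal]
      have h1 : ((p.Vxᵀ * B) *ᵥ u) (σ.symm (Sum.inl k)) =
          (p.Vxᵀ * B).row (σ.symm (Sum.inl k)) ⬝ᵥ u := rfl
      rw [h1, ← hused, smul_dotProduct, smul_eq_mul]
      have h2 := hl k
      field_simp
    rw [← hu]
    rfl
  have hmaps : Set.MapsTo (fun w : (Fin ry → ℝ) × (Fin B.rank → ℝ) =>
      p.Wx *ᵥ w.1 + p.Vx *ᵥ (permMatrix σ *ᵥ
        Sum.elim (fun k => (1 + γ / (Bt.col k ⬝ᵥ Bt.col k)) * w.2 k) 0) + c)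
      Set.univ (dataSpace A B c) := by
    rintro w -
    refine ⟨w.1, (X₀ * p.Vx) *ᵥ (permMatrix σ *ᵥ
      Sum.elim (fun k => (1 + γ / (Bt.col k ⬝ᵥ Bt.col k)) * w.2 k) 0), ?_⟩
    simp only [groundTruth, hBX, h.Wx_eq]
  have hright : Set.RightInvOn (fun w : (Fin ry → ℝ) × (Fin B.rank → ℝ) =>
      p.Wx *ᵥ w.1 + p.Vx *ᵥ (permMatrix σ *ᵥ
        Sum.elim (fun k => (1 + γ / (Bt.col k ⬝ᵥ Bt.col k)) * w.2 k) 0) + c)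
      (fun x => (p.yhat x, Wt *ᵥ x + bt)) Set.univ := by
    rintro ⟨y, m⟩ -
    set v := permMatrix σ *ᵥ
      Sum.elim (fun k => (1 + γ / (Bt.col k ⬝ᵥ Bt.col k)) * m k) 0 with hv
    have hx : p.Wx *ᵥ y + p.Vx *ᵥ v + c = groundTruth A B c y ((X₀ * p.Vx) *ᵥ v) := by
      simp only [groundTruth, hBX, h.Wx_eq]
    simp only [← hv, hx, hyhat, Prod.mk.injEq, true_and]
    funext k
    rw [hWtx]
    have hpos : 0 < (p.Vxᵀ * p.Vx) (σ.symm (Sum.inl k)) (σ.symm (Sum.inl k)) :=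
      lt_of_le_of_ne (hnn _) (hl k).symm
    have h1 : ((p.Vxᵀ * p.Vx) (σ.symm (Sum.inl k)) (σ.symm (Sum.inl k)) + γ) *
        ((p.Wz * B).row (σ.symm (Sum.inl k)) ⬝ᵥ ((X₀ * p.Vx) *ᵥ v)) =
        ((p.Vxᵀ * p.Vx) (σ.symm (Sum.inl k)) (σ.symm (Sum.inl k)) + γ) * m k := by
      rw [← smul_eq_mul, ← smul_dotProduct, hused]
      have h2 : (p.Vxᵀ * B).row (σ.symm (Sum.inl k)) ⬝ᵥ ((X₀ * p.Vx) *ᵥ v) =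
          ((p.Vxᵀ * p.Vx) *ᵥ v) (σ.symm (Sum.inl k)) := by
        have h3 : (p.Vxᵀ * p.Vx) *ᵥ v = (p.Vxᵀ * B) *ᵥ ((X₀ * p.Vx) *ᵥ v) := by
          rw [← mulVec_mulVec, ← mulVec_mulVec, hBX]
        rw [h3]
        rfl
      rw [h2, transpose_mul_self_eq_diagonal h.orthogonal, mulVec_diagonal, hv,
        permMatrix_mulVec_apply, Equiv.apply_symm_apply, Sum.elim_inl, hcc]
      field_simp
      rw [Matrix.diagonal_apply_eq]
      field_simp
    exact mul_left_cancel₀ (by linarith) h1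
  refine ⟨σ, Bt, Wt, bt, R, r, ?_, ?_, ?_, ?_, fun i hi => ?_, ?_, fun hrx => ?_,
    fun j => (hpruned j).2, hyhat, Set.InvOn.bijOn ⟨hleft, hright⟩ (Set.mapsTo_univ _ _) hmaps,
    hleft, hright⟩
  · ext a k
    refine Eq.trans ?_ (mul_permMatrix_transpose_apply σ (fromCols Bt 0) a k).symm
    obtain ⟨t, rfl⟩ := σ.symm.surjective k
    rcases t with i | j
    · simp [hBt]
    · simpa using congrFun (hcol j) a
  · rw [← hrange]
    refine le_antisymm ?_ ?_
    · rintro _ ⟨f, rfl⟩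
      exact ⟨_, hBtV f⟩
    · rintro _ ⟨v, rfl⟩
      exact ⟨_, (hVBt v).symm⟩
  · ext k a
    rw [permMatrix_mul_apply]
    obtain ⟨t, rfl⟩ := σ.symm.surjective k
    rcases t with i | j <;> simp [hWt, hR]
  · funext k
    rw [permMatrix_mulVec_apply]
    obtain ⟨t, rfl⟩ := σ.symm.surjective k
    rcases t with i | j <;> simp [hbt, hrdef]
  · -- a vanishing encoder row would make `Bᵀ v_k` vanish
    set k := σ.symm (Sum.inl i) with hk
    have h1 : (p.Wz * B).row k = 0 := by
      have : p.Wz k = 0 := hi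
      funext a
      simp [Matrix.mul_apply, this]
    have h2 := hused i
    rw [← hk, h1, smul_zero] at h2
    have h3 := hδ ((X₀ * p.Vx).col k)
    have h4 : B *ᵥ (X₀ * p.Vx).col k = p.Vx.col k := by
      conv_rhs => rw [← h.projection_Vx]
      rw [Matrix.mul_assoc]
      rfl
    have h5 : Bᵀ *ᵥ p.Vx.col k = 0 := by
      rw [mulVec_transpose]
      exact h2.symm
    rw [h4, h5, zero_dotProduct] at h3
    have h6 : 0 < p.Vx.col k ⬝ᵥ p.Vx.col k := lt_of_le_of_ne (hnn k) (hl i).symm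
    nlinarith
  · rintro _ ⟨y, u, rfl⟩
    funext j
    have := hmean y u (σ.symm (Sum.inr j))
    rw [(hpruned j).1, zero_dotProduct] at this
    exact this
  · have htop : LinearMap.range A.mulVecLin ⊔ LinearMap.range B.mulVecLin = ⊤ := by
      refine Submodule.eq_top_of_finrank_eq ?_
      rw [IsAffineSurjectiveModel.finrank_range_sup hDA hDB, hrx]
      simp
    have hR0 : R = 0 := by
      refine ext_of_mulVec_single fun i => ?_
      have hmem : (Pi.single i 1 : Fin rx → ℝ) ∈
          LinearMap.range A.mulVecLin ⊔ LinearMap.range B.mulVecLin := htop ▸ Submodule.mem_top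
      obtain ⟨_, ⟨y, rfl⟩, _, ⟨u, rfl⟩, hyu⟩ := Submodule.mem_sup.1 hmem
      rw [← hyu]
      funext j
      have h1 : (p.Wz *ᵥ (A *ᵥ y + B *ᵥ u)) (σ.symm (Sum.inr j)) = 0 := by
        rw [mulVec_add, mulVec_mulVec, mulVec_mulVec, h.Wz_mul_A, zero_mulVec, zero_add]
        change (p.Wz * B).row (σ.symm (Sum.inr j)) ⬝ᵥ u = 0
        rw [(hpruned j).1, zero_dotProduct]
      rw [zero_mulVec]
      exact h1
    refine ⟨hR0, ?_⟩
    have h1 : r = -(R *ᵥ c) := by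
      funext j
      exact congrFun h.bz_eq _
    rw [h1, hR0, zero_mulVec, neg_zero]

end IsOptimal

end CycleCVAE

theorem corollary3 {Ω : Type*} [MeasurableSpace Ω] (μ : Measure Ω) [IsProbabilityMeasure μ]
    {rx ry ru rz : ℕ} (A : Matrix (Fin rx) (Fin ry) ℝ) (B : Matrix (Fin rx) (Fin ru) ℝ)
    (c : Fin rx → ℝ) (D : Matrix (Fin ry) (Fin rx) ℝ) (e : Fin ry → ℝ)
    (Y : Ω → Fin ry → ℝ) (U : Ω → Fin ru → ℝ)
    (hmodel : CycleCVAE.IsAffineSurjectiveModel μ A B c D e Y U)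
    (hrz : (CycleCVAE.secondMoment (CycleCVAE.lawX μ A B c Y U)).rank - ry ≤ rz) :
    ∃ γ₀ : ℝ, 0 < γ₀ ∧ ∀ (γ : ℝ) (p : CycleCVAE.Params rx ry rz),
      ((0 < γ ∧ γ < γ₀ ∧ p.IsMinimum (CycleCVAE.lawX μ A B c Y U) (μ.map Y) γ) ∨
        (γ = 0 ∧ p.IsLimitMinimum (CycleCVAE.lawX μ A B c Y U) (μ.map Y))) →
      ∃ (σ : Fin rz ≃ Fin B.rank ⊕ Fin (rz - B.rank))
        (Bt : Matrix (Fin rx) (Fin B.rank) ℝ)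
        (Wt : Matrix (Fin B.rank) (Fin rx) ℝ) (bt : Fin B.rank → ℝ)
        (R : Matrix (Fin (rz - B.rank)) (Fin rx) ℝ) (r : Fin (rz - B.rank) → ℝ),
        -- the permutation is the one that sorts the columns of the decoder weight `V_x`
        p.Vx = Matrix.fromCols Bt 0 * (CycleCVAE.permMatrix σ)ᵀ ∧
        LinearMap.range Bt.mulVecLin = LinearMap.range B.mulVecLin ∧
        -- the encoder: `rank B` nonzero rows, the others vanish
        p.Wz = CycleCVAE.permMatrix σ * Matrix.fromRows Wt R ∧
        p.bz = CycleCVAE.permMatrix σ *ᵥ Sum.elim bt r ∧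
        (∀ i, Wt i ≠ 0) ∧
        (∀ x ∈ CycleCVAE.dataSpace A B c, R *ᵥ x + r = 0) ∧
        (ry + B.rank = rx → R = 0 ∧ r = 0) ∧
        (∀ j, p.s (σ.symm (Sum.inr j)) ^ 2 = 1) ∧
        -- the matched `y` is recovered from `x`
        (∀ y u, p.yhat (CycleCVAE.groundTruth A B c y u) = y) ∧
        -- the bijection between `x` and `(y, W̃_z x + b̃_z)`, and its affine inverse
        Set.BijOn (fun x => (p.yhat x, Wt *ᵥ x + bt)) (CycleCVAE.dataSpace A B c) Set.univ ∧
        Set.InvOn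
          (fun w : (Fin ry → ℝ) × (Fin B.rank → ℝ) =>
            p.Wx *ᵥ w.1 + p.Vx *ᵥ (CycleCVAE.permMatrix σ *ᵥ
              Sum.elim (fun k => (1 + γ / (Bt.col k ⬝ᵥ Bt.col k)) * w.2 k) 0) + c)
          (fun x => (p.yhat x, Wt *ᵥ x + bt)) (CycleCVAE.dataSpace A B c) Set.univ := by
  have hrank : B.rank ≤ rz := by
    have := hmodel.add_rank_le_rank_secondMoment
    omega
  obtain ⟨X₀, hX⟩ := CycleCVAE.exists_normal_equation B
  obtain ⟨δ, hδ0, hδ⟩ := CycleCVAE.exists_lower_bound B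
  refine ⟨δ, hδ0, fun γ p hp => ?_⟩
  rcases hp with ⟨hγ, hγδ, hmin⟩ | ⟨rfl, g, q, hg, hg0, hq, hqp⟩
  · exact (hmodel.isOptimal_of_isMinimum hX hδ hrank hγ hγδ hmin).exists_sorted hγ.le hγδ hδ
      hmodel.D_mul_A hmodel.D_mul_B
  · have hopt : CycleCVAE.IsOptimal 0 δ A B c X₀ p :=
      (CycleCVAE.isClosed_isOptimal δ A B c X₀).mem_of_tendsto (hg0.prodMk_nhds hqp)
        ((hg0.eventually_lt_const hδ0).mono fun n hn =>
          hmodel.isOptimal_of_isMinimum hX hδ hrank (hg n) hn (hq n))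
    exact hopt.exists_sorted le_rfl hδ0 hδ hmodel.D_mul_A hmodel.D_mul_B
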